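/- Let $\gamma$ be a simple closed plane curve, regular and of class $C^2$; "inside $\gamma$" refers to the closed region bounded by $\gamma$ (the curve together with the bounded components of its complement). A circle supports $\gamma$ from inside if it touches $\gamma$ and lies in this region. For a point $p$ of $\gamma$, the incircle $C_p$ is the circle of largest radius that lies inside $\gamma$ and passes through $p$. Let $\gamma_1$ be an arc of $\gamma$ (possibly the whole curve, regarded as a loop) whose endpoints lie on $C_p$ and which has no other point in common with $C_p$. Then there is a point $q$ of $\gamma_1$, distinct from its endpoints, at which the curvature of $\gamma$ is nonzero and the osculating circle of $\gamma$ supports $\gamma$ from inside. Moreover, let $\gamma_1\neq\gamma_2$ be two such arcs, and let $q_i$ be a point of $\gamma_i$ ($i=1,2$) at which the osculating circle of $\gamma$ exists (nonzero curvature) and supports $\gamma$ from inside. Then the closed discs bounded by these two osculating circles (in particular, the circles themselves) can intersect only in the closed disc bounded by $C_p$; and if neither $q_i$ is an endpoint of $\gamma_i$, they can intersect only in the open disc bounded by $C_p$. -/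

import Mathlib

/-- A simple closed plane curve: a regular twice continuously differentiable curve in the
Euclidean plane `ℂ`, given by a periodic parametrization of period `T` which is injective on
one period. -/
structure IsSimpleClosedCurve (γ : ℝ → ℂ) (T : ℝ) : Prop where
  period_pos : 0 < T
  periodic : Function.Periodic γ T
  contDiff : ContDiff ℝ 2 γ
  regular : ∀ t, deriv γ t ≠ 0
  simple : Set.InjOn γ (Set.Ico 0 T)

/-- The points enclosed by the curve: those lying in a bounded connected component of the
complement of its trace. -/
def curveInside (γ : ℝ → ℂ) : Set ℂ :=
  {z | z ∉ Set.range γ ∧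
    Bornology.IsBounded (connectedComponentIn (Set.range γ)ᶜ z)}

/-- The closed region bounded by the curve: its trace together with the enclosed points. -/
def closedRegion (γ : ℝ → ℂ) : Set ℂ :=
  Set.range γ ∪ curveInside γ

/-- The circle with center `c` and radius `r > 0` supports `γ` from inside at the point `q` of
`γ`: it passes through `q` and lies in the closed region bounded by `γ`. -/
structure SupportsFromInsideAt (γ : ℝ → ℂ) (q c : ℂ) (r : ℝ) : Prop where
  radius_pos : 0 < r
  mem_curve : q ∈ Set.range γ
  mem_circle : q ∈ Metric.sphere c r
  subset_region : Metric.sphere c r ⊆ closedRegion γ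

/-- The circle with center `c` and radius `r` is the incircle of `γ` at `p`: the largest circle
that lies inside `γ` and touches it at `p`. -/
def IsIncircle (γ : ℝ → ℂ) (p c : ℂ) (r : ℝ) : Prop :=
  SupportsFromInsideAt γ p c r ∧
    ∀ (c' : ℂ) (r' : ℝ), SupportsFromInsideAt γ p c' r' → r' ≤ r

/-- Signed curvature `det (γ', γ'') / |γ'| ^ 3` of a plane curve. -/
noncomputable def signedCurvature (γ : ℝ → ℂ) (t : ℝ) : ℝ :=
  ((starRingEnd ℂ) (deriv γ t) * deriv (deriv γ) t).im / ‖deriv γ t‖ ^ 3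

/-- Unit normal of a plane curve: the unit tangent turned by a right angle counterclockwise. -/
noncomputable def unitNormal (γ : ℝ → ℂ) (t : ℝ) : ℂ :=
  Complex.I * deriv γ t / (‖deriv γ t‖ : ℂ)

/-- The circle with center `c` and radius `r` is the osculating circle of `γ` at parameter `t`
(where the curvature vanishes there is no such circle: it degenerates to the tangent line). -/
def IsOsculatingCircle (γ : ℝ → ℂ) (t : ℝ) (c : ℂ) (r : ℝ) : Prop :=
  signedCurvature γ t ≠ 0 ∧
    c = γ t + ((signedCurvature γ t)⁻¹ : ℝ) * unitNormal γ t ∧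
    r = |signedCurvature γ t|⁻¹

/-- The arc `γ '' [a, b]` of a closed curve of period `T` meets the circle with center `c` and
radius `r` at its endpoints and nowhere else. The case `b = a + T`, where the arc is the whole
curve regarded as a loop based at `γ a`, is allowed. -/
structure IsArcTouchingOnlyAtEnds (γ : ℝ → ℂ) (T : ℝ) (c : ℂ) (r a b : ℝ) : Prop where
  lt : a < b
  le : b ≤ a + T
  left_mem : γ a ∈ Metric.sphere c r
  right_mem : γ b ∈ Metric.sphere c r
  not_mem : ∀ t ∈ Set.Ioo a b, γ t ∉ Metric.sphere c r

open Filter Topology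

/-! A disc of radius `r` supporting `γ` from inside at `γ t` has its center on the inner normal, and
the squared distance from that center to `γ (t + h)` is `r ^ 2` plus the squared chord length times
`1 - r * (σ * chordCurvature γ t h)`. Since `γ` is of class C², `chordCurvature` is continuous also
at `h = 0`, where it is the curvature. The disc whose radius is the inverse of the maximum of `σ *
chordCurvature γ t h` over `h` therefore supports `γ`, and either touches it a second time or is
osculating (`exists_supportsFromInsideAt`).

The planar input is `false_of_isPreconnected_of_crosscut`: the chord of a supporting disc, together
with an arc of `γ` between its ends, separates the inner side of that arc from the outside. If a
second disc touched `γ` both on the arc, off the first circle, and beyond the arc, its part beyond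
the radical line of the two circles would join what is separated. So contacts of two supporting
discs do not interleave (`mem_sphere_of_interleaved`).

Existence: take the largest disc at a parameter inside the arc. By maximality of `C_p`, a supporting
disc touching `γ` at a point of `C_p` is contained in the disc of `C_p`; hence a second contact is
off `C_p`, and by non-interleaving it lies on the same arc. Among the touching pairs between these
two contacts choose one with closest parameters. If they were distinct, the largest disc at their
midpoint would produce a closer pair; so they coincide and the disc is osculating.

Intersection: let `z` be common to two discs with contacts inside different arcs, and outside the
open disc of `C_p`. The caps of both discs, joined at `z`, lead from the inner side of the first arc
to a point of the second, so `z` lies on the first arc and, by symmetry, on the second. Being a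
contact point, `z` is not on `C_p`, and the arcs coincide. A disc at an endpoint is contained in
that of `C_p`.

The Jordan curve theorem is not invoked: separation comes from continuous logarithms, and the two
sides of `γ` from tubes of normal segments. -/

/-! ### Continuous logarithms and separation of the plane -/

/-- The relation between `x` and `y` is transitive, by adding logarithms. It holds when `y` is
closer to `x` than `L` is, since then `(z - y) / (z - x)` stays within distance 1 of 1 and the
principal logarithm applies. -/
theorem exists_continuousOn_log_div_of_isPreconnected {L W : Set ℂ} (hL : IsCompact L)
    (hW : IsPreconnected W) (hWL : Disjoint W L) {x y : ℂ} (hx : x ∈ W) (hy : y ∈ W) :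
    ∃ g : ℂ → ℂ, ContinuousOn g L ∧ ∀ z ∈ L, Complex.exp (g z) = (z - x) / (z - y) := by
  have hne : ∀ x ∈ W, ∀ z ∈ L, z - x ≠ 0 := fun x hx z hz h =>
    Set.disjoint_left.1 hWL hx (sub_eq_zero.1 h ▸ hz)
  refine hW.induction₂' (fun x y => ∃ g : ℂ → ℂ, ContinuousOn g L ∧
    ∀ z ∈ L, Complex.exp (g z) = (z - x) / (z - y)) ?_ ?_ hx hy
  · intro x hx
    obtain ⟨δ, hδ, hball⟩ := Metric.isOpen_iff.1 hL.isClosed.isOpen_compl x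
      (Set.disjoint_left.1 hWL hx)
    filter_upwards [self_mem_nhdsWithin, nhdsWithin_le_nhds (Metric.ball_mem_nhds x hδ)]
      with y hyW hy
    have key : ∀ z ∈ L, (z - y) / (z - x) ∈ Complex.slitPlane := by
      intro z hz
      have h1 : δ ≤ ‖z - x‖ := by
        by_contra h
        exact hball (by simpa [dist_eq_norm] using h) hz
      have h2 : (z - y) / (z - x) = 1 + (x - y) / (z - x) := by
        have := hne x hx z hz
        field_simp
        ring
      rw [h2]
      apply Complex.mem_slitPlane_of_norm_lt_one
      rw [norm_div, div_lt_one (by linarith), norm_sub_rev]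
      exact lt_of_lt_of_le (by simpa [dist_eq_norm] using hy) h1
    have hcont : ContinuousOn (fun z => Complex.log ((z - y) / (z - x))) L :=
      ContinuousOn.clog (ContinuousOn.div (by fun_prop) (by fun_prop) (hne x hx)) key
    refine ⟨⟨_, hcont.neg, fun z hz => ?_⟩, ⟨_, hcont, fun z hz => ?_⟩⟩
    · rw [Pi.neg_apply, Complex.exp_neg, Complex.exp_log (div_ne_zero (hne y hyW z hz) (hne x hx z hz)), inv_div]
    · rw [Complex.exp_log (div_ne_zero (hne y hyW z hz) (hne x hx z hz))]
  · rintro x y z - hy - ⟨g, hg, hg'⟩ ⟨k, hk, hk'⟩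
    refine ⟨_, hg.add hk, fun w hw => ?_⟩
    rw [Pi.add_apply, Complex.exp_add, hg' w hw, hk' w hw]
    have := hne y hy w hw
    field_simp

theorem IsPreconnected.eqOn_of_exp_eq_one {S : Set ℂ} (hS : IsPreconnected S) {f : ℂ → ℂ}
    (hf : ContinuousOn f S) (h : ∀ z ∈ S, Complex.exp (f z) = 1) {x y : ℂ} (hx : x ∈ S)
    (hy : y ∈ S) : f x = f y := by
  have hd : IsDiscrete (Set.range ((↑) : ℤ → ℂ)) := by
    rw [← Set.image_univ]
    exact IsDiscrete.univ.image Complex.isometry_intCast.isEmbedding.isInducing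
  have hmaps : Set.MapsTo (fun z => f z / (2 * Real.pi * Complex.I)) S
      (Set.range ((↑) : ℤ → ℂ)) := by
    intro z hz
    obtain ⟨n, hn⟩ := Complex.exp_eq_one_iff.1 (h z hz)
    refine ⟨n, ?_⟩
    have := Complex.two_pi_I_ne_zero
    simp only [hn]
    field_simp
  have := hS.constant_of_mapsTo hd (hf.div_const _) hmaps hx hy
  exact (div_left_inj' Complex.two_pi_I_ne_zero).1 this

/-- A closed curve crossed transversally exactly once, at the point `γ m`, by the segment from
`γ m - v` to `γ m + v` separates the endpoints of this segment. -/
theorem false_of_isPreconnected_of_crosses_once {L₀ W : Set ℂ} {γ : ℝ → ℂ} {m : ℝ} {d v : ℂ}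
    (hL : IsCompact (insert (γ m) L₀)) (hL₀ : IsPreconnected L₀) (hγ : HasDerivAt γ d m)
    (hmem : ∀ᶠ u in 𝓝[≠] m, γ u ∈ L₀) (hv : (d * (starRingEnd ℂ) v).im ≠ 0)
    (hseg : ∀ s ∈ Set.Icc (-1 : ℝ) 1, γ m + s * v ∉ L₀) (hW : IsPreconnected W)
    (hWL : Disjoint W (insert (γ m) L₀)) (h₁ : γ m - v ∈ W) (h₂ : γ m + v ∈ W) : False := by
  obtain ⟨g, hg, hg'⟩ := exists_continuousOn_log_div_of_isPreconnected hL hW hWL h₁ h₂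
  set ratio : ℂ → ℂ := fun z => (z - (γ m - v)) / (z - (γ m + v)) with hratio
  have hv0 : v ≠ 0 := by
    rintro rfl
    simp at hv
  have hne₁ : ∀ z ∈ L₀, z - (γ m - v) ≠ 0 := fun z hz h =>
    Set.disjoint_left.1 hWL h₁ (sub_eq_zero.1 h ▸ Set.mem_insert_of_mem _ hz)
  have hne₂ : ∀ z ∈ L₀, z - (γ m + v) ≠ 0 := fun z hz h =>
    Set.disjoint_left.1 hWL h₂ (sub_eq_zero.1 h ▸ Set.mem_insert_of_mem _ hz)
  -- The ratio takes a value `-t` with `t ≥ 0` only at `γ m + ((t - 1) / (1 + t)) * v`, a point of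
  -- the crossing segment.
  have hslit : ∀ z ∈ L₀, ratio z ∈ Complex.slitPlane := by
    intro z hz
    rw [Complex.mem_slitPlane_iff_not_le_zero]
    intro hle
    obtain ⟨t, ht, hte⟩ : ∃ t : ℝ, 0 ≤ t ∧ ratio z = -(t : ℂ) := by
      refine ⟨-(ratio z).re, by simpa using hle.1, ?_⟩
      apply Complex.ext <;> simp [hle.2]
    have ht1 : (1 + t : ℂ) ≠ 0 := by
      have : (1 + t : ℝ) ≠ 0 := by positivity
      exact_mod_cast this
    rw [hratio, div_eq_iff (hne₂ z hz)] at hte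
    refine hseg ((t - 1) / (1 + t)) ⟨?_, ?_⟩ ?_
    · rw [le_div_iff₀ (by positivity)]; linarith
    · rw [div_le_iff₀ (by positivity)]; linarith
    · convert hz using 1
      push_cast
      field_simp
      linear_combination -hte
  have hcontr : ContinuousOn ratio L₀ :=
    ContinuousOn.div (by fun_prop) (by fun_prop) hne₂
  have hconst : ∀ z ∈ L₀, ∀ w ∈ L₀,
      g z - Complex.log (ratio z) = g w - Complex.log (ratio w) := by
    intro z hz w hw
    refine hL₀.eqOn_of_exp_eq_one (f := fun z => g z - Complex.log (ratio z))
      ((hg.mono (Set.subset_insert _ _)).sub (hcontr.clog hslit)) ?_ hz hw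
    intro z hz
    rw [Complex.exp_sub, hg' z (Set.mem_insert_of_mem _ hz), Complex.exp_log, div_self]
    all_goals exact div_ne_zero (hne₁ z hz) (hne₂ z hz)
  have hγc : Tendsto γ (𝓝[≠] m) (𝓝 (γ m)) := hγ.continuousAt.tendsto.mono_left nhdsWithin_le_nhds
  have hratio_m : ratio (γ m) = -1 := by
    simp only [hratio]
    rw [div_eq_iff (by simpa using hv0)]
    ring
  have hlim : Tendsto (fun u => ratio (γ u)) (𝓝[≠] m) (𝓝 (-1)) := by
    rw [← hratio_m]
    refine Tendsto.comp (ContinuousAt.tendsto ?_) hγc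
    exact ContinuousAt.div (by fun_prop) (by fun_prop) (by simpa using hv0)
  have hglim : Tendsto (fun u => g (γ u)) (𝓝[≠] m) (𝓝 (g (γ m))) :=
    (hg _ (Set.mem_insert _ _)).tendsto.comp (tendsto_nhdsWithin_iff.2
      ⟨hγc, hmem.mono fun u hu => Set.mem_insert_of_mem _ hu⟩)
  have him : ∀ u, (ratio (γ u)).im =
      -2 * ((γ u - γ m) * (starRingEnd ℂ) v).im / Complex.normSq (γ u - (γ m + v)) := by
    intro u
    simp only [hratio, Complex.div_im, Complex.sub_re, Complex.sub_im, Complex.add_re,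
      Complex.add_im, Complex.mul_im, Complex.conj_re, Complex.conj_im]
    ring
  have hslope : Tendsto (fun u => ((γ u - γ m) * (starRingEnd ℂ) v).im / (u - m)) (𝓝[≠] m)
      (𝓝 (d * (starRingEnd ℂ) v).im) := by
    have h := hasDerivAt_iff_tendsto_slope.1 hγ
    have h' := (Complex.continuous_im.tendsto _).comp (h.mul_const ((starRingEnd ℂ) v))
    refine h'.congr fun u => ?_
    simp only [slope, vsub_eq_sub, Function.comp, Complex.real_smul, mul_assoc,
      Complex.im_ofReal_mul]
    ring
  have hns : ∀ᶠ u in 𝓝[≠] m, 0 < Complex.normSq (γ u - (γ m + v)) := by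
    have : ∀ᶠ z in 𝓝 (γ m), z - (γ m + v) ≠ 0 :=
      (ContinuousAt.eventually_ne (by fun_prop) (by simpa using hv0))
    filter_upwards [hγc.eventually this] with u hu
    exact Complex.normSq_pos.2 hu
  -- Transversality: on the two sides of `m` the ratio approaches `-1` from opposite sides of the
  -- branch cut. The principal logarithm then tends to `-πi` and `πi`, whereas `g`, which differs
  -- from it by a constant on `L₀`, has a single limit.
  obtain ⟨l₁, l₂, hl₁, hl₂, hb₁, hb₂, hn, hp⟩ : ∃ l₁ l₂ : Filter ℝ, l₁ ≤ 𝓝[≠] m ∧ l₂ ≤ 𝓝[≠] m ∧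
      l₁.NeBot ∧ l₂.NeBot ∧ (∀ᶠ u in l₁, (ratio (γ u)).im < 0) ∧
      (∀ᶠ u in l₂, 0 < (ratio (γ u)).im) := by
    have hgt : 𝓝[>] m ≤ 𝓝[≠] m := nhdsWithin_mono _ fun u hu => ne_of_gt hu
    have hlt : 𝓝[<] m ≤ 𝓝[≠] m := nhdsWithin_mono _ fun u hu => ne_of_lt hu
    rcases lt_or_gt_of_ne hv with h | h
    · have hev := hslope.eventually (eventually_lt_nhds h)
      refine ⟨𝓝[<] m, 𝓝[>] m, hlt, hgt, inferInstance, inferInstance, ?_, ?_⟩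
      · filter_upwards [hlt hev, hlt hns, self_mem_nhdsWithin] with u hu hu2 (hu3 : u < m)
        rw [him]
        apply div_neg_of_neg_of_pos _ hu2
        rw [div_neg_iff] at hu
        rcases hu with hu | hu <;> linarith
      · filter_upwards [hgt hev, hgt hns, self_mem_nhdsWithin] with u hu hu2 (hu3 : m < u)
        rw [him]
        apply div_pos _ hu2
        rw [div_neg_iff] at hu
        rcases hu with hu | hu <;> linarith
    · have hev := hslope.eventually (eventually_gt_nhds h)
      refine ⟨𝓝[>] m, 𝓝[<] m, hgt, hlt, inferInstance, inferInstance, ?_, ?_⟩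
      · filter_upwards [hgt hev, hgt hns, self_mem_nhdsWithin] with u hu hu2 (hu3 : m < u)
        rw [him]
        apply div_neg_of_neg_of_pos _ hu2
        rw [div_pos_iff] at hu
        rcases hu with hu | hu <;> linarith
      · filter_upwards [hlt hev, hlt hns, self_mem_nhdsWithin] with u hu hu2 (hu3 : u < m)
        rw [him]
        apply div_pos _ hu2
        rw [div_pos_iff] at hu
        rcases hu with hu | hu <;> linarith
  have hlog₁ : Tendsto (fun u => Complex.log (ratio (γ u))) l₁ (𝓝 (-(Real.pi * Complex.I))) := by
    have h := Complex.tendsto_log_nhdsWithin_im_neg_of_re_neg_of_im_zero (z := -1)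
      (by simp) (by simp)
    have h' := h.comp (tendsto_nhdsWithin_iff.2 ⟨hlim.mono_left hl₁, hn⟩)
    simpa [Function.comp_def] using h'
  have hlog₂ : Tendsto (fun u => Complex.log (ratio (γ u))) l₂ (𝓝 (Real.pi * Complex.I)) := by
    have h := Complex.tendsto_log_nhdsWithin_im_nonneg_of_re_neg_of_im_zero (z := -1)
      (by simp) (by simp)
    have h' := h.comp (tendsto_nhdsWithin_iff.2 ⟨hlim.mono_left hl₂, hp.mono fun u hu => hu.le⟩)
    simpa [Function.comp_def] using h'
  obtain ⟨u₀, hu₀⟩ := hmem.exists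
  have e₁ := tendsto_nhds_unique_of_eventuallyEq ((hglim.mono_left hl₁).sub hlog₁)
    tendsto_const_nhds ((hmem.filter_mono hl₁).mono fun u hu => hconst _ hu _ hu₀)
  have e₂ := tendsto_nhds_unique_of_eventuallyEq ((hglim.mono_left hl₂).sub hlog₂)
    tendsto_const_nhds ((hmem.filter_mono hl₂).mono fun u hu => hconst _ hu _ hu₀)
  apply Complex.two_pi_I_ne_zero
  linear_combination e₁ - e₂

/-! ### Parametrization and normal frame of the curve -/

namespace IsSimpleClosedCurve

variable {γ : ℝ → ℂ} {T : ℝ}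

theorem exists_int_of_eq (hγ : IsSimpleClosedCurve γ T) {s t : ℝ} (h : γ s = γ t) :
    ∃ k : ℤ, s = t + k * T := by
  have key : ∀ u, γ (toIcoMod hγ.period_pos 0 u) = γ u := fun u => by
    rw [toIcoMod, zsmul_eq_mul]
    exact hγ.periodic.sub_int_mul_eq _
  have hmem : ∀ u, toIcoMod hγ.period_pos 0 u ∈ Set.Ico 0 T := fun u => by
    simpa using toIcoMod_mem_Ico hγ.period_pos 0 u
  have h1 := hγ.simple (hmem s) (hmem t) (by rw [key, key, h])
  refine ⟨toIcoDiv hγ.period_pos 0 s - toIcoDiv hγ.period_pos 0 t, ?_⟩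
  simp only [toIcoMod, zsmul_eq_mul] at h1
  push_cast
  linarith

theorem eq_of_abs_sub_lt (hγ : IsSimpleClosedCurve γ T) {s t : ℝ} (h : γ s = γ t)
    (hst : |s - t| < T) : s = t := by
  obtain ⟨k, rfl⟩ := hγ.exists_int_of_eq h
  have hT := hγ.period_pos
  rw [add_sub_cancel_left, abs_mul, abs_of_pos hT, mul_lt_iff_lt_one_left hT] at hst
  have : k = 0 := Int.abs_lt_one_iff.1 (by exact_mod_cast hst)
  simp [this]

theorem continuous (hγ : IsSimpleClosedCurve γ T) : Continuous γ := hγ.contDiff.continuous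

theorem isCompact_range (hγ : IsSimpleClosedCurve γ T) : IsCompact (Set.range γ) := by
  rw [← hγ.periodic.image_Icc hγ.period_pos 0]
  exact isCompact_Icc.image hγ.continuous

theorem hasDerivAt (hγ : IsSimpleClosedCurve γ T) (t : ℝ) : HasDerivAt γ (deriv γ t) t :=
  (hγ.contDiff.differentiable (by norm_num)).differentiableAt.hasDerivAt

theorem contDiff_deriv (hγ : IsSimpleClosedCurve γ T) : ContDiff ℝ 1 (deriv γ) :=
  (contDiff_succ_iff_deriv.1 hγ.contDiff).2.2

theorem continuous_deriv (hγ : IsSimpleClosedCurve γ T) : Continuous (deriv γ) :=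
  hγ.contDiff_deriv.continuous

theorem hasDerivAt_deriv (hγ : IsSimpleClosedCurve γ T) (t : ℝ) :
    HasDerivAt (deriv γ) (deriv (deriv γ) t) t :=
  (hγ.contDiff_deriv.differentiable (by norm_num)).differentiableAt.hasDerivAt

theorem continuous_deriv_deriv (hγ : IsSimpleClosedCurve γ T) : Continuous (deriv (deriv γ)) :=
  hγ.contDiff_deriv.continuous_deriv le_rfl

theorem norm_deriv_pos (hγ : IsSimpleClosedCurve γ T) (t : ℝ) : 0 < ‖deriv γ t‖ :=
  norm_pos_iff.2 (hγ.regular t)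

theorem continuous_unitNormal (hγ : IsSimpleClosedCurve γ T) : Continuous (unitNormal γ) := by
  unfold unitNormal
  have := hγ.continuous_deriv
  exact Continuous.div (by fun_prop) (by fun_prop)
    fun t => by exact_mod_cast (hγ.norm_deriv_pos t).ne'

theorem norm_unitNormal (hγ : IsSimpleClosedCurve γ T) (t : ℝ) : ‖unitNormal γ t‖ = 1 := by
  have := (hγ.norm_deriv_pos t).ne'
  simp [unitNormal, this]

theorem inner_deriv_unitNormal (t : ℝ) :
    inner ℝ (deriv γ t) (unitNormal γ t) = 0 := by
  simp only [unitNormal, Complex.inner, Complex.div_ofReal_re, Complex.mul_re,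
    Complex.mul_im, Complex.conj_re, Complex.conj_im, Complex.I_re, Complex.I_im,
    Complex.div_ofReal_im]
  ring

theorem eq_inner_smul_unitNormal (hγ : IsSimpleClosedCurve γ T) {t : ℝ} {w : ℂ}
    (h : inner ℝ (deriv γ t) w = 0) :
    w = (inner ℝ w (unitNormal γ t) : ℝ) • unitNormal γ t := by
  have hd := (hγ.norm_deriv_pos t).ne'
  have hsq : (deriv γ t).re ^ 2 + (deriv γ t).im ^ 2 = ‖deriv γ t‖ ^ 2 := by
    rw [← Complex.normSq_eq_norm_sq, Complex.normSq_apply]; ring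
  simp only [Complex.inner, Complex.mul_re, Complex.conj_re, Complex.conj_im] at h
  apply Complex.ext
  all_goals
    simp only [unitNormal, Complex.inner, Complex.real_smul, Complex.div_ofReal_re,
      Complex.mul_re, Complex.mul_im, Complex.conj_re, Complex.conj_im, Complex.I_re,
      Complex.I_im, Complex.div_ofReal_im, Complex.ofReal_re, Complex.ofReal_im]
    field_simp
  · linear_combination -w.re * hsq + (deriv γ t).re * h
  · linear_combination -w.im * hsq + (deriv γ t).im * h

end IsSimpleClosedCurve

/-! ### Chord curvature -/

/-- The mean velocity `(γ (t + h) - γ t) / h` of a curve, equal to `deriv γ t` for `h = 0`. -/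
noncomputable def chordSlope (γ : ℝ → ℂ) (t h : ℝ) : ℂ :=
  ∫ x in (0 : ℝ)..1, deriv γ (t + x * h)

/-- The second order Taylor remainder `(γ (t + h) - γ t - h • deriv γ t) / h ^ 2` of a curve. -/
noncomputable def chordBend (γ : ℝ → ℂ) (t h : ℝ) : ℂ :=
  ∫ x in (0 : ℝ)..1, (1 - x) • deriv (deriv γ) (t + x * h)

/-- The signed curvature of the circle tangent to `γ` at `γ t` and passing through `γ (t + h)`;
for `h = 0` it is the signed curvature of `γ`. -/
noncomputable def chordCurvature (γ : ℝ → ℂ) (t h : ℝ) : ℝ :=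
  2 * inner ℝ (chordBend γ t h) (unitNormal γ t) / ‖chordSlope γ t h‖ ^ 2

namespace IsSimpleClosedCurve

variable {γ : ℝ → ℂ} {T : ℝ}

theorem smul_chordSlope (hγ : IsSimpleClosedCurve γ T) (t h : ℝ) :
    h • chordSlope γ t h = γ (t + h) - γ t := by
  have hc := hγ.continuous_deriv
  have hd : ∀ x : ℝ, HasDerivAt (fun x : ℝ => γ (t + x * h)) (h • deriv γ (t + x * h)) x := by
    intro x
    have := (hγ.hasDerivAt (t + x * h)).scomp x (((hasDerivAt_id x).mul_const h).const_add t)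
    simpa [Function.comp_def] using this
  have := intervalIntegral.integral_eq_sub_of_hasDerivAt (a := 0) (b := 1) (fun x _ => hd x)
    (Continuous.intervalIntegrable (by fun_prop) _ _)
  rw [intervalIntegral.integral_smul] at this
  simpa [chordSlope] using this

theorem sq_smul_chordBend (hγ : IsSimpleClosedCurve γ T) (t h : ℝ) :
    h ^ 2 • chordBend γ t h = γ (t + h) - γ t - h • deriv γ t := by
  have hc := hγ.continuous_deriv_deriv
  have hd : ∀ x : ℝ, HasDerivAt
      (fun x : ℝ => γ (t + x * h) + (1 - x) • (h • deriv γ (t + x * h)))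
      (h ^ 2 • ((1 - x) • deriv (deriv γ) (t + x * h))) x := by
    intro x
    have hl : HasDerivAt (fun x : ℝ => t + x * h) h x := by
      simpa using ((hasDerivAt_id x).mul_const h).const_add t
    have h1 := (hγ.hasDerivAt (t + x * h)).scomp x hl
    have h2 := (hγ.hasDerivAt_deriv (t + x * h)).scomp x hl
    have h3 := h1.add (((hasDerivAt_id x).const_sub 1).smul (h2.const_smul h))
    refine h3.congr_deriv ?_
    simp only [Function.comp, id, Complex.real_smul, Pi.smul_apply]
    push_cast
    ring
  have := intervalIntegral.integral_eq_sub_of_hasDerivAt (a := 0) (b := 1) (fun x _ => hd x)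
    (Continuous.intervalIntegrable (by fun_prop) _ _)
  rw [intervalIntegral.integral_smul] at this
  rw [chordBend, this]
  simp
  ring

theorem chordSlope_ne_zero (hγ : IsSimpleClosedCurve γ T) (t : ℝ) {h : ℝ} (hh : |h| < T) :
    chordSlope γ t h ≠ 0 := by
  intro h0
  rcases eq_or_ne h 0 with rfl | hne
  · exact hγ.regular t (by simpa [chordSlope] using h0)
  · have h1 := hγ.smul_chordSlope t h
    rw [h0, smul_zero] at h1
    exact hne (by simpa using hγ.eq_of_abs_sub_lt (sub_eq_zero.1 h1.symm) (by simpa using hh))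

theorem continuousOn_chordCurvature (hγ : IsSimpleClosedCurve γ T) :
    ContinuousOn (fun q : ℝ × ℝ => chordCurvature γ q.1 q.2) {q | |q.2| < T} := by
  have h1 := hγ.continuous_deriv
  have h2 := hγ.continuous_deriv_deriv
  have h3 := hγ.continuous_unitNormal
  have hS : Continuous fun q : ℝ × ℝ => chordSlope γ q.1 q.2 := by
    unfold chordSlope
    apply intervalIntegral.continuous_parametric_intervalIntegral_of_continuous'
    fun_prop
  have hB : Continuous fun q : ℝ × ℝ => chordBend γ q.1 q.2 := by
    unfold chordBend
    apply intervalIntegral.continuous_parametric_intervalIntegral_of_continuous'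
    fun_prop
  unfold chordCurvature
  refine ContinuousOn.div (Continuous.continuousOn ?_) (by fun_prop) ?_
  · exact continuous_const.mul (hB.inner (h3.comp continuous_fst))
  · intro q hq
    exact pow_ne_zero _ (norm_ne_zero_iff.2 (hγ.chordSlope_ne_zero q.1 hq))

theorem chordCurvature_zero (t : ℝ) :
    chordCurvature γ t 0 = signedCurvature γ t := by
  have hi : ∫ x in (0 : ℝ)..1, (1 - x) = 1 / 2 := by
    rw [intervalIntegral.integral_sub (by simp) (by simp)]
    norm_num
  have hb : chordBend γ t 0 = (1 / 2 : ℝ) • deriv (deriv γ) t := by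
    simp only [chordBend, mul_zero, add_zero, intervalIntegral.integral_smul_const, hi]
  have hs : chordSlope γ t 0 = deriv γ t := by simp [chordSlope]
  rw [chordCurvature, signedCurvature, hb, hs]
  by_cases hd : ‖deriv γ t‖ = 0
  · simp [hd]
  simp only [unitNormal, Complex.inner, Complex.real_smul, Complex.div_ofReal_re,
      Complex.mul_re, Complex.mul_im, Complex.conj_re, Complex.conj_im, Complex.I_re,
      Complex.I_im, Complex.div_ofReal_im, Complex.ofReal_re, Complex.ofReal_im]
  field_simp
  ring

/-- With `n` the unit normal, expanding the square leaves `⟪γ (t + h) - γ t, n⟫`, which the Taylor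
remainder expresses through `chordCurvature`. The sign of `1 - s * chordCurvature γ t h` thus tells
on which side of the circle tangent at `γ t` the point lies. -/
theorem norm_sub_normal_sq (hγ : IsSimpleClosedCurve γ T) (t : ℝ) {h : ℝ} (hh : |h| < T) (s : ℝ) :
    ‖γ (t + h) - (γ t + s • unitNormal γ t)‖ ^ 2 =
      s ^ 2 + ‖γ (t + h) - γ t‖ ^ 2 * (1 - s * chordCurvature γ t h) := by
  have hne : ‖chordSlope γ t h‖ ≠ 0 := norm_ne_zero_iff.2 (hγ.chordSlope_ne_zero t hh)
  have h1 : inner ℝ (γ (t + h) - γ t) (unitNormal γ t) =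
      h ^ 2 * inner ℝ (chordBend γ t h) (unitNormal γ t) := by
    rw [← real_inner_smul_left, hγ.sq_smul_chordBend, inner_sub_left _ (h • deriv γ t),
      real_inner_smul_left, inner_deriv_unitNormal]
    ring
  have h2 : ‖γ (t + h) - γ t‖ ^ 2 * chordCurvature γ t h =
      2 * inner ℝ (γ (t + h) - γ t) (unitNormal γ t) := by
    rw [h1, ← hγ.smul_chordSlope, norm_smul, chordCurvature, mul_pow, Real.norm_eq_abs, sq_abs]
    field_simp
  rw [← sub_sub, norm_sub_sq_real, real_inner_smul_right, norm_smul, hγ.norm_unitNormal,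
    mul_one, Real.norm_eq_abs, sq_abs]
  linear_combination s * h2

/-- Reduces all points of the curve to a compact range of `h` inside `|h| < T`, where
`chordCurvature` is continuous. -/
theorem exists_abs_le_eq (hγ : IsSimpleClosedCurve γ T) (t u : ℝ) :
    ∃ h : ℝ, |h| ≤ T / 2 ∧ γ (t + h) = γ u := by
  obtain ⟨v, hv, hv'⟩ := hγ.periodic.exists_mem_Ico hγ.period_pos u (t - T / 2)
  refine ⟨v - t, abs_le.2 ⟨by linarith [hv.1], by linarith [hv.2]⟩, ?_⟩
  rw [hv', add_sub_cancel]

theorem chordCurvature_periodic (hγ : IsSimpleClosedCurve γ T) (h : ℝ) :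
    Function.Periodic (fun t => chordCurvature γ t h) T := by
  have h1 : Function.Periodic (deriv γ) T := by
    intro t
    rw [← deriv_comp_add_const]
    congr 1
    exact funext hγ.periodic
  have h2 : Function.Periodic (deriv (deriv γ)) T := by
    intro t
    rw [← deriv_comp_add_const]
    congr 1
    exact funext h1
  intro t
  have e1 : ∀ x, deriv γ (t + T + x * h) = deriv γ (t + x * h) := fun x => by
    rw [← h1 (t + x * h)]; ring_nf
  have e2 : ∀ x, deriv (deriv γ) (t + T + x * h) = deriv (deriv γ) (t + x * h) := fun x => by
    rw [← h2 (t + x * h)]; ring_nf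
  simp only [chordCurvature, chordBend, chordSlope, unitNormal, e1, e2, h1 t]

/-- Short normal segments of the curve leave the curve immediately. -/
theorem exists_forall_normal_notMem_range (hγ : IsSimpleClosedCurve γ T) :
    ∃ ε > 0, ∀ t s : ℝ, s ≠ 0 → |s| < ε → γ t + s • unitNormal γ t ∉ Set.range γ := by
  have hT := hγ.period_pos
  obtain ⟨C, hC⟩ := ((isCompact_Icc (a := (0 : ℝ)) (b := T)).prod
    (isCompact_Icc (a := -(T / 2)) (b := T / 2))).exists_bound_of_continuousOn
    (hγ.continuousOn_chordCurvature.mono fun q hq => by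
      have := abs_le.2 hq.2
      show |q.2| < T
      linarith)
  have hC' : ∀ t h, |h| ≤ T / 2 → |chordCurvature γ t h| ≤ |C| := by
    intro t h hh
    obtain ⟨t', ht', he⟩ := (hγ.chordCurvature_periodic h).exists_mem_Ico₀ hT t
    rw [show chordCurvature γ t h = chordCurvature γ t' h from he]
    exact (hC (t', h) ⟨⟨ht'.1, ht'.2.le⟩, abs_le.1 hh⟩).trans (le_abs_self C)
  -- With this bound `s * chordCurvature γ t h ≤ 1`, so every point of the curve has distance at
  -- least `|s|` from `γ t + s • unitNormal γ t`.
  refine ⟨1 / (|C| + 1), by positivity, ?_⟩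
  rintro t s hs0 hs ⟨u, hu⟩
  obtain ⟨h, hh, hhu⟩ := hγ.exists_abs_le_eq t u
  have h1 := hγ.norm_sub_normal_sq t (h := h) (by linarith) s
  rw [hhu, hu, sub_self, norm_zero] at h1
  have h2 : s * chordCurvature γ t h ≤ 1 := by
    calc s * chordCurvature γ t h ≤ |s * chordCurvature γ t h| := le_abs_self _
      _ = |s| * |chordCurvature γ t h| := abs_mul _ _
      _ ≤ 1 / (|C| + 1) * (|C| + 1) := by
        gcongr
        linarith [hC' t h hh]
      _ = 1 := by field_simp
  have h3 : 0 < s ^ 2 := by positivity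
  nlinarith [sq_nonneg ‖γ t + s • unitNormal γ t - γ t‖]

end IsSimpleClosedCurve

/-! ### Inside, outside and the two sides of the curve -/

theorem Complex.isPreconnected_setOf_lt_norm (R : ℝ) :
    IsPreconnected {z : ℂ | R < ‖z‖} := by
  have h : {z : ℂ | R < ‖z‖} =
      (fun q : ℝ × ℝ => (q.1 : ℂ) * Complex.exp (q.2 * Complex.I)) '' (Set.Ioi R ×ˢ Set.univ) := by
    ext z
    constructor
    · intro hz
      exact ⟨(‖z‖, z.arg), ⟨hz, trivial⟩, Complex.norm_mul_exp_arg_mul_I z⟩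
    · rintro ⟨⟨ϱ, θ⟩, ⟨hϱ : R < ϱ, -⟩, rfl⟩
      simp only [Set.mem_ofPred_eq, norm_mul, Complex.norm_real, Complex.norm_exp_ofReal_mul_I,
        mul_one]
      exact hϱ.trans_le (le_abs_self ϱ)
  rw [h]
  exact (isPreconnected_Ioi.prod isPreconnected_univ).image _ (by fun_prop)

section Region

variable {γ : ℝ → ℂ} {T : ℝ}

theorem mem_compl_closedRegion {z : ℂ} : z ∈ (closedRegion γ)ᶜ ↔ z ∉ Set.range γ ∧
    ¬ Bornology.IsBounded (connectedComponentIn (Set.range γ)ᶜ z) := by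
  simp only [closedRegion, curveInside, Set.mem_compl_iff, Set.mem_union, Set.mem_ofPred_eq]
  tauto

theorem mem_curveInside_or {z : ℂ} (hz : z ∉ Set.range γ) :
    z ∈ curveInside γ ∨ z ∈ (closedRegion γ)ᶜ := by
  rw [mem_compl_closedRegion]
  simp only [curveInside, Set.mem_ofPred_eq]
  tauto

theorem IsPreconnected.subset_curveInside {S : Set ℂ} (hS : IsPreconnected S)
    (hd : Disjoint S (Set.range γ)) {z : ℂ} (hz : z ∈ S) (hzi : z ∈ curveInside γ) :
    S ⊆ curveInside γ := by
  intro w hw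
  have hsub := hS.subset_connectedComponentIn hz hd.subset_compl_right
  refine ⟨Set.disjoint_left.1 hd hw, ?_⟩
  rw [← connectedComponentIn_eq (hsub hw)]
  exact hzi.2

theorem IsPreconnected.subset_compl_closedRegion {S : Set ℂ} (hS : IsPreconnected S)
    (hd : Disjoint S (Set.range γ)) {z : ℂ} (hz : z ∈ S) (hzo : z ∈ (closedRegion γ)ᶜ) :
    S ⊆ (closedRegion γ)ᶜ := by
  intro w hw
  rcases mem_curveInside_or (Set.disjoint_left.1 hd hw) with h | h
  · exact absurd (Or.inr (hS.subset_curveInside hd hw h hz)) hzo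
  · exact h

namespace IsSimpleClosedCurve

theorem exists_setOf_lt_norm_subset (hγ : IsSimpleClosedCurve γ T) :
    ∃ R : ℝ, {z : ℂ | R < ‖z‖} ⊆ (closedRegion γ)ᶜ := by
  obtain ⟨R, hR⟩ := hγ.isCompact_range.isBounded.exists_norm_le
  have hsub : {z : ℂ | R < ‖z‖} ⊆ (Set.range γ)ᶜ := fun z hz hz' => not_lt.2 (hR z hz') hz
  refine ⟨R, fun z hz => mem_compl_closedRegion.2 ⟨hsub hz, fun hb => ?_⟩⟩
  obtain ⟨M, hM⟩ := (hb.subset ((Complex.isPreconnected_setOf_lt_norm R).subset_connectedComponentIn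
    hz hsub)).exists_norm_le
  have h1 := hM ((max R M + 1 : ℝ) : ℂ) (by
    simp only [Set.mem_ofPred_eq, Complex.norm_real, Real.norm_eq_abs]
    exact lt_of_lt_of_le (by linarith [le_max_left R M]) (le_abs_self _))
  rw [Complex.norm_real, Real.norm_eq_abs] at h1
  linarith [le_abs_self (max R M + 1), le_max_right R M]

theorem isBounded_closedRegion (hγ : IsSimpleClosedCurve γ T) :
    Bornology.IsBounded (closedRegion γ) := by
  obtain ⟨R, hR⟩ := hγ.exists_setOf_lt_norm_subset
  refine isBounded_iff_forall_norm_le.2 ⟨R, fun z hz => ?_⟩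
  by_contra h
  exact hR (not_le.1 h) hz

/-- Every unbounded component of the complement reaches the connected set of points of large norm,
so all of them contain the same far point `w`. -/
theorem isPreconnected_compl_closedRegion (hγ : IsSimpleClosedCurve γ T) :
    IsPreconnected (closedRegion γ)ᶜ := by
  obtain ⟨R, hR⟩ := hγ.exists_setOf_lt_norm_subset
  set w : ℂ := ((max R 0 + 1 : ℝ) : ℂ)
  have hw : ∀ z ∈ (closedRegion γ)ᶜ, w ∈ connectedComponentIn (Set.range γ)ᶜ z := by
    intro z hz
    rw [mem_compl_closedRegion] at hz
    have hb : ∃ v ∈ connectedComponentIn (Set.range γ)ᶜ z, max R 0 < ‖v‖ := by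
      by_contra! h
      exact hz.2 (isBounded_iff_forall_norm_le.2 ⟨_, h⟩)
    obtain ⟨v, hv, hv'⟩ := hb
    rw [connectedComponentIn_eq hv]
    refine (Complex.isPreconnected_setOf_lt_norm (max R 0)).subset_connectedComponentIn
      hv' (fun x hx => (mem_compl_closedRegion.1 (hR ((le_max_left R 0).trans_lt hx))).1) ?_
    simp only [w, Set.mem_ofPred_eq, Complex.norm_real, Real.norm_eq_abs]
    exact lt_of_lt_of_le (by linarith) (le_abs_self _)
  refine isPreconnected_of_forall w fun z hz => ⟨_, ?_, hw z hz,
    mem_connectedComponentIn (mem_compl_closedRegion.1 hz).1, isPreconnected_connectedComponentIn⟩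
  exact isPreconnected_connectedComponentIn.subset_compl_closedRegion
    (Set.disjoint_left.2 fun x hx => connectedComponentIn_subset _ _ hx)
    (mem_connectedComponentIn (mem_compl_closedRegion.1 hz).1) hz

theorem isClosed_closedRegion (hγ : IsSimpleClosedCurve γ T) : IsClosed (closedRegion γ) := by
  rw [← isOpen_compl_iff, isOpen_iff_mem_nhds]
  intro z hz
  have hz' := (mem_compl_closedRegion.1 hz).1
  refine mem_of_superset ((hγ.isCompact_range.isClosed.isOpen_compl.connectedComponentIn).mem_nhds
    (mem_connectedComponentIn hz')) ?_
  exact isPreconnected_connectedComponentIn.subset_compl_closedRegion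
    (Set.disjoint_left.2 fun x hx => connectedComponentIn_subset _ _ hx)
    (mem_connectedComponentIn hz') hz

/-- If `γ u` is a point of the curve nearest to `z`, then `z` lies on the normal at `γ u`. -/
theorem eq_add_smul_unitNormal_of_forall_le (hγ : IsSimpleClosedCurve γ T) {z : ℂ} {u : ℝ}
    (h : ∀ v, ‖γ u - z‖ ≤ ‖γ v - z‖) :
    ∃ s : ℝ, |s| = ‖γ u - z‖ ∧ z = γ u + s • unitNormal γ u := by
  have hd : HasDerivAt (fun v => ‖γ v - z‖ ^ 2) (2 * inner ℝ (γ u - z) (deriv γ u)) u :=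
    ((hγ.hasDerivAt u).sub_const z).norm_sq
  have hmin : IsLocalMin (fun v => ‖γ v - z‖ ^ 2) u :=
    Eventually.of_forall fun v =>
      pow_le_pow_left₀ (norm_nonneg _) (h v) 2
  have h0 := hmin.hasDerivAt_eq_zero hd
  have h1 : inner ℝ (deriv γ u) (z - γ u) = 0 := by
    rw [← neg_sub, inner_neg_right, real_inner_comm]
    linarith
  have h2 := hγ.eq_inner_smul_unitNormal h1
  refine ⟨_, ?_, eq_add_of_sub_eq' h2⟩
  have h3 := congrArg norm h2
  rw [norm_smul, hγ.norm_unitNormal, mul_one, Real.norm_eq_abs] at h3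
  rw [← h3, norm_sub_rev]

theorem exists_forall_norm_sub_le (hγ : IsSimpleClosedCurve γ T) (z : ℂ) :
    ∃ u, ∀ v, ‖γ u - z‖ ≤ ‖γ v - z‖ := by
  obtain ⟨q, ⟨u, rfl⟩, hu⟩ := hγ.isCompact_range.exists_isMinOn (Set.range_nonempty γ)
    (f := fun w => ‖w - z‖) (by fun_prop)
  exact ⟨u, fun v => hu ⟨v, rfl⟩⟩

end IsSimpleClosedCurve

/-- The outside is connected and unbounded; if it met the disc it would have to cross the circle. -/
theorem closedBall_subset_closedRegion (hγ : IsSimpleClosedCurve γ T) {c : ℂ} {r : ℝ}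
    (hr : 0 < r) (h : Metric.sphere c r ⊆ closedRegion γ) :
    Metric.closedBall c r ⊆ closedRegion γ := by
  intro z hz
  by_contra hzo
  obtain ⟨R, hR⟩ := hγ.exists_setOf_lt_norm_subset
  have hw : ∃ w : ℂ, R < ‖w‖ ∧ r < ‖w - c‖ := by
    refine ⟨((|R| + ‖c‖ + r + 1 : ℝ) : ℂ), ?_, ?_⟩
    · rw [Complex.norm_real, Real.norm_eq_abs]
      refine lt_of_lt_of_le ?_ (le_abs_self _)
      linarith [le_abs_self R, norm_nonneg c]
    · refine lt_of_lt_of_le ?_ (norm_sub_norm_le _ _)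
      rw [Complex.norm_real, Real.norm_eq_abs]
      linarith [le_abs_self (|R| + ‖c‖ + r + 1), abs_nonneg R]
  obtain ⟨w, hw1, hw2⟩ := hw
  obtain ⟨x, hx, hx'⟩ := hγ.isPreconnected_compl_closedRegion.intermediate_value
    (f := fun x => ‖x - c‖) hzo (hR hw1) (by fun_prop)
    ⟨by simpa [dist_eq_norm] using hz, hw2.le⟩
  exact hx (h (by simpa [dist_eq_norm] using hx'))

/-- The sign `σ` for which `σ • unitNormal γ` points to the inside of the curve; normal segments
of length less than `ε` on either side of the curve do not meet it. -/
structure IsInnerSign (γ : ℝ → ℂ) (σ ε : ℝ) : Prop where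
  sq_eq : σ ^ 2 = 1
  pos : 0 < ε
  inside : ∀ t s : ℝ, 0 < s → s < ε → γ t + s • σ • unitNormal γ t ∈ curveInside γ
  outside : ∀ t s : ℝ, 0 < s → s < ε → γ t - s • σ • unitNormal γ t ∈ (closedRegion γ)ᶜ

/-- The tubes of short normals on either side of the curve are connected and miss the curve, so each
is wholly inside or wholly outside. By nearest-point projection they cover all points near the curve
but off it. Outside points accumulate at a frontier point of the region, which lies on the curve;
the disc bounded by the given circle supplies inside points. So one tube is of each kind. -/
theorem exists_isInnerSign (hγ : IsSimpleClosedCurve γ T) {c : ℂ} {r : ℝ} (hr : 0 < r)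
    (hp : (Metric.sphere c r ∩ Set.range γ).Nonempty)
    (h : Metric.sphere c r ⊆ closedRegion γ) : ∃ σ ε, IsInnerSign γ σ ε := by
  obtain ⟨ε, hε, htube⟩ := hγ.exists_forall_normal_notMem_range
  let A : ℝ → Set ℂ := fun σ =>
    (fun q : ℝ × ℝ => γ q.1 + q.2 • σ • unitNormal γ q.1) '' (Set.univ ×ˢ Set.Ioo 0 ε)
  have hA : ∀ σ, IsPreconnected (A σ) := by
    intro σ
    have h1 := hγ.continuous
    have h2 := hγ.continuous_unitNormal
    exact (isPreconnected_univ.prod isPreconnected_Ioo).image _ (by fun_prop)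
  have hAd : ∀ σ : ℝ, |σ| = 1 → Disjoint (A σ) (Set.range γ) := by
    rintro σ hσ
    rw [Set.disjoint_left]
    rintro _ ⟨⟨t, s⟩, ⟨-, hs⟩, rfl⟩
    have hs0 : (0 : ℝ) < s := hs.1
    have hs1 : s < ε := hs.2
    simp only [smul_smul]
    refine htube t (s * σ) (mul_ne_zero hs0.ne' ?_) ?_
    · rintro rfl
      simp at hσ
    · rwa [abs_mul, hσ, mul_one, abs_of_pos hs0]
  have hnear : ∀ z ∉ Set.range γ, (∃ u, ‖γ u - z‖ < ε) → ∃ σ : ℝ, (σ = 1 ∨ σ = -1) ∧ z ∈ A σ := by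
    rintro z hz ⟨v, hv⟩
    obtain ⟨u, hu⟩ := hγ.exists_forall_norm_sub_le z
    obtain ⟨s, hs, hzs⟩ := hγ.eq_add_smul_unitNormal_of_forall_le hu
    have hs' : |s| < ε := hs ▸ (hu v).trans_lt hv
    have hs0 : s ≠ 0 := by
      rintro rfl
      exact hz ⟨u, by simpa using hzs.symm⟩
    rcases lt_or_gt_of_ne hs0 with hneg | hpos
    · refine ⟨-1, Or.inr rfl, (u, -s), ⟨trivial, by simpa using hneg, ?_⟩, ?_⟩
      · simpa [abs_of_neg hneg] using hs'
      · simpa using hzs.symm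
    · refine ⟨1, Or.inl rfl, (u, s), ⟨trivial, hpos, ?_⟩, ?_⟩
      · simpa [abs_of_pos hpos] using hs'
      · simpa using hzs.symm
  have hAmem : ∀ σ t s : ℝ, 0 < s → s < ε → γ t + s • σ • unitNormal γ t ∈ A σ :=
    fun σ t s h0 h1 => ⟨(t, s), ⟨trivial, h0, h1⟩, rfl⟩
  have hnear_range : ∀ (U : Set ℂ), IsOpen U → ∀ u, γ u ∈ U → ∀ σ, ∃ z ∈ U, z ∈ A σ := by
    intro U hU u hu σ
    have hc : Tendsto (fun s : ℝ => γ u + s • σ • unitNormal γ u) (𝓝[>] 0) (𝓝 (γ u)) := by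
      have : Continuous fun s : ℝ => γ u + s • σ • unitNormal γ u := by fun_prop
      simpa using (this.tendsto 0).mono_left nhdsWithin_le_nhds
    obtain ⟨s, hs1, hs2⟩ := ((hc.eventually (hU.mem_nhds hu)).and
      (Ioo_mem_nhdsGT hε)).exists
    exact ⟨_, hs1, hAmem σ u s hs2.1 hs2.2⟩
  have hσabs : ∀ σ : ℝ, σ = 1 ∨ σ = -1 → |σ| = 1 := by
    rintro σ (rfl | rfl) <;> simp
  have hout : ∃ σ : ℝ, (σ = 1 ∨ σ = -1) ∧ A σ ⊆ (closedRegion γ)ᶜ := by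
    obtain ⟨R, hR⟩ := hγ.exists_setOf_lt_norm_subset
    have hne : (frontier (closedRegion γ)).Nonempty := by
      rw [nonempty_frontier_iff]
      refine ⟨⟨γ 0, Or.inl ⟨0, rfl⟩⟩, fun heq => ?_⟩
      refine hR (a := ((|R| + 1 : ℝ) : ℂ)) ?_ (heq ▸ Set.mem_univ _)
      simp only [Set.mem_ofPred_eq, Complex.norm_real, Real.norm_eq_abs]
      exact lt_of_lt_of_le (by linarith [le_abs_self R]) (le_abs_self _)
    obtain ⟨q, hq⟩ := hne
    have hq1 : q ∈ closedRegion γ := hγ.isClosed_closedRegion.frontier_subset hq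
    have hq2 : q ∈ closure (closedRegion γ)ᶜ := by
      rw [frontier_eq_closure_inter_closure] at hq
      exact hq.2
    have hqr : q ∈ Set.range γ := by
      by_contra hqr
      have hopen := hγ.isCompact_range.isClosed.isOpen_compl.connectedComponentIn (x := q)
      obtain ⟨w, hw, hw'⟩ := mem_closure_iff.1 hq2 _ hopen (mem_connectedComponentIn hqr)
      exact isPreconnected_connectedComponentIn.subset_compl_closedRegion
        (Set.disjoint_left.2 fun x hx => connectedComponentIn_subset _ _ hx) hw hw'
        (mem_connectedComponentIn hqr) hq1
    obtain ⟨u, rfl⟩ := hqr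
    obtain ⟨z, hz, hzo⟩ := mem_closure_iff.1 hq2 _ Metric.isOpen_ball (Metric.mem_ball_self hε)
    obtain ⟨σ, hσ, hzA⟩ := hnear z (mem_compl_closedRegion.1 hzo).1
      ⟨u, by rw [norm_sub_rev]; simpa [dist_eq_norm] using hz⟩
    exact ⟨σ, hσ, (hA σ).subset_compl_closedRegion (hAd σ (hσabs σ hσ)) hzA hzo⟩
  have hin : ∃ σ : ℝ, (σ = 1 ∨ σ = -1) ∧ A σ ⊆ curveInside γ := by
    have hball : Metric.ball c r ⊆ closedRegion γ :=
      Metric.ball_subset_closedBall.trans (closedBall_subset_closedRegion hγ hr h)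
    obtain ⟨z, hzA, hzc⟩ : ∃ z, (∃ σ : ℝ, (σ = 1 ∨ σ = -1) ∧ z ∈ A σ) ∧ z ∈ closedRegion γ := by
      -- It is not yet known that the open disc misses the curve; if it does not, a normal at a
      -- curve point in the disc already gives a tube point of the region.
      by_cases hb : ∃ u, γ u ∈ Metric.ball c r
      · obtain ⟨u, hu⟩ := hb
        obtain ⟨z, hz, hzA⟩ := hnear_range _ Metric.isOpen_ball u hu 1
        exact ⟨z, ⟨1, Or.inl rfl, hzA⟩, hball hz⟩
      · obtain ⟨_, hp1, u, rfl⟩ := hp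
        have hcl : γ u ∈ closure (Metric.ball c r) := by
          rw [closure_ball c hr.ne']
          exact Metric.sphere_subset_closedBall hp1
        obtain ⟨z, hz, hzb⟩ := mem_closure_iff.1 hcl _ Metric.isOpen_ball (Metric.mem_ball_self hε)
        refine ⟨z, hnear z ?_ ⟨u, ?_⟩, hball hzb⟩
        · rintro ⟨v, rfl⟩
          exact hb ⟨v, hzb⟩
        · rw [norm_sub_rev]
          simpa [dist_eq_norm] using hz
    obtain ⟨σ, hσ, hzA⟩ := hzA
    have hzr := Set.disjoint_left.1 (hAd σ (hσabs σ hσ)) hzA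
    exact ⟨σ, hσ, (hA σ).subset_curveInside (hAd σ (hσabs σ hσ)) hzA (hzc.resolve_left hzr)⟩
  obtain ⟨σ, hσ, hσi⟩ := hin
  obtain ⟨τ, hτ, hτo⟩ := hout
  have hne : τ ≠ σ := by
    rintro rfl
    have hm := hAmem τ 0 (ε / 2) (by positivity) (by linarith)
    exact hτo hm (Or.inr (hσi hm))
  have hτσ : τ = -σ := by
    rcases hσ with rfl | rfl <;> rcases hτ with rfl | rfl <;> simp_all
  subst hτσ
  refine ⟨σ, ε, by rcases hσ with rfl | rfl <;> norm_num, hε,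
    fun t s h0 h1 => hσi (hAmem σ t s h0 h1), fun t s h0 h1 => ?_⟩
  have := hτo (hAmem (-σ) t s h0 h1)
  rwa [neg_smul, smul_neg, ← sub_eq_add_neg] at this

end Region

/-! ### Caps of balls beyond a radical hyperplane -/

section Lune

variable {E : Type*} [NormedAddCommGroup E] [InnerProductSpace ℝ E]

/-- The quadratic terms cancel: a difference of powers with respect to two spheres is affine, which
makes the radical locus a hyperplane. -/
theorem norm_sub_sq_sub_norm_sub_sq_combo {a b : ℝ} (hab : a + b = 1) (x y c c' : E) :
    ‖a • x + b • y - c‖ ^ 2 - ‖a • x + b • y - c'‖ ^ 2 =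
      a * (‖x - c‖ ^ 2 - ‖x - c'‖ ^ 2) + b * (‖y - c‖ ^ 2 - ‖y - c'‖ ^ 2) := by
  simp only [norm_sub_sq_real _ c, norm_sub_sq_real _ c', inner_add_left, real_inner_smul_left]
  linear_combination (‖c'‖ ^ 2 - ‖c‖ ^ 2) * hab

theorem norm_combo_sub_lt {a b : ℝ} (ha : 0 < a) (hb : 0 ≤ b) (hab : a + b = 1) {x y c : E} {r : ℝ}
    (hx : ‖x - c‖ < r) (hy : ‖y - c‖ ≤ r) : ‖a • x + b • y - c‖ < r := by
  have h : a • x + b • y - c = a • (x - c) + b • (y - c) := by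
    rw [smul_sub, smul_sub, sub_add_sub_comm, ← add_smul, hab, one_smul]
  rw [h]
  calc ‖a • (x - c) + b • (y - c)‖ ≤ ‖a • (x - c)‖ + ‖b • (y - c)‖ := norm_add_le _ _
    _ = a * ‖x - c‖ + b * ‖y - c‖ := by
      rw [norm_smul, norm_smul, Real.norm_of_nonneg ha.le, Real.norm_of_nonneg hb]
    _ < a * r + b * r := by
      have := mul_lt_mul_of_pos_left hx ha
      have := mul_le_mul_of_nonneg_left hy hb
      linarith
    _ = r := by rw [← add_mul, hab, one_mul]

/-- The part of the open ball of center `c'` and radius `r'` lying beyond the radical hyperplane of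
this ball and the ball of center `c` and radius `r`. -/
def radicalCap (c : E) (r : ℝ) (c' : E) (r' : ℝ) : Set E :=
  {w | ‖w - c'‖ < r' ∧ ‖w - c'‖ ^ 2 - r' ^ 2 < ‖w - c‖ ^ 2 - r ^ 2}

theorem combo_mem_radicalCap {c c' : E} {r r' : ℝ} {a b : ℝ} (ha : 0 < a) (hb : 0 ≤ b)
    (hab : a + b = 1) {x y : E} (hx : x ∈ radicalCap c r c' r') (hy : ‖y - c'‖ ≤ r')
    (hy' : ‖y - c'‖ ^ 2 - r' ^ 2 ≤ ‖y - c‖ ^ 2 - r ^ 2) :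
    a • x + b • y ∈ radicalCap c r c' r' := by
  refine ⟨norm_combo_sub_lt ha hb hab hx.1 hy, ?_⟩
  have h := norm_sub_sq_sub_norm_sub_sq_combo hab x y c c'
  have h1 := mul_lt_mul_of_pos_left hx.2 ha
  have h2 := mul_le_mul_of_nonneg_left hy' hb
  have h3 : r' ^ 2 - r ^ 2 = a * (r' ^ 2 - r ^ 2) + b * (r' ^ 2 - r ^ 2) := by
    rw [← add_mul, hab, one_mul]
  linarith

theorem convex_radicalCap (c : E) (r : ℝ) (c' : E) (r' : ℝ) :
    Convex ℝ (radicalCap c r c' r') := by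
  rw [convex_iff_forall_pos]
  intro x hx y hy a b ha hb hab
  exact combo_mem_radicalCap ha hb.le hab hx hy.1.le hy.2.le

theorem mem_closure_radicalCap {c c' : E} {r r' : ℝ} (h : (radicalCap c r c' r').Nonempty) {y : E}
    (hy : ‖y - c'‖ ≤ r') (hy' : ‖y - c'‖ ^ 2 - r' ^ 2 ≤ ‖y - c‖ ^ 2 - r ^ 2) :
    y ∈ closure (radicalCap c r c' r') := by
  obtain ⟨x, hx⟩ := h
  have hsub : openSegment ℝ x y ⊆ radicalCap c r c' r' := by
    rintro _ ⟨a, b, ha, hb, hab, rfl⟩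
    exact combo_mem_radicalCap ha hb.le hab hx hy hy'
  exact closure_mono hsub (segment_subset_closure_openSegment (right_mem_segment ℝ x y))

/-- The endpoints have zero power for the first sphere and nonnegative power for the second, so they
lie on the other side of the radical hyperplane, and so does their chord. -/
theorem disjoint_radicalCap_segment {c c' : E} {r r' : ℝ} (hr' : 0 ≤ r') {x y : E}
    (hx : ‖x - c‖ = r) (hy : ‖y - c‖ = r) (hx' : r' ≤ ‖x - c'‖) (hy' : r' ≤ ‖y - c'‖) :
    Disjoint (radicalCap c r c' r') (segment ℝ x y) := by
  rw [Set.disjoint_left]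
  rintro _ hw ⟨a, b, ha, hb, hab, rfl⟩
  have h := norm_sub_sq_sub_norm_sub_sq_combo hab x y c c'
  rw [hx, hy] at h
  have h1 := mul_le_mul_of_nonneg_left (pow_le_pow_left₀ hr' hx' 2) ha
  have h2 := mul_le_mul_of_nonneg_left (pow_le_pow_left₀ hr' hy' 2) hb
  have h3 : r' ^ 2 - r ^ 2 = a * (r' ^ 2 - r ^ 2) + b * (r' ^ 2 - r ^ 2) := by
    rw [← add_mul, hab, one_mul]
  have := hw.2
  linarith

end Lune

/-! ### Supporting discs and crosscuts -/

section Supporting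

variable {γ : ℝ → ℂ} {T σ ε : ℝ}

theorem SupportsFromInsideAt.of_mem_sphere {q c : ℂ} {r : ℝ} (h : SupportsFromInsideAt γ q c r)
    {t : ℝ} (ht : γ t ∈ Metric.sphere c r) : SupportsFromInsideAt γ (γ t) c r :=
  ⟨h.radius_pos, ⟨t, rfl⟩, ht, h.subset_region⟩

theorem SupportsFromInsideAt.closedBall_subset (hγ : IsSimpleClosedCurve γ T) {q c : ℂ} {r : ℝ}
    (h : SupportsFromInsideAt γ q c r) : Metric.closedBall c r ⊆ closedRegion γ :=
  closedBall_subset_closedRegion hγ h.radius_pos h.subset_region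

namespace IsInnerSign

theorem abs_eq (hσ : IsInnerSign γ σ ε) : |σ| = 1 := by
  rcases sq_eq_sq_iff_eq_or_eq_neg.1 (hσ.sq_eq.trans (one_pow 2).symm) with rfl | rfl <;> simp

theorem norm_normal (hσ : IsInnerSign γ σ ε) (hγ : IsSimpleClosedCurve γ T) (t : ℝ) :
    ‖σ • unitNormal γ t‖ = 1 := by
  rw [norm_smul, Real.norm_eq_abs, hσ.abs_eq, hγ.norm_unitNormal, mul_one]

theorem range_subset_closure (hσ : IsInnerSign γ σ ε) :
    Set.range γ ⊆ closure (closedRegion γ)ᶜ := by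
  rintro _ ⟨u, rfl⟩
  have hc : Tendsto (fun s : ℝ => γ u - s • σ • unitNormal γ u) (𝓝[>] 0) (𝓝 (γ u)) := by
    have : Continuous fun s : ℝ => γ u - s • σ • unitNormal γ u := by fun_prop
    simpa using (this.tendsto 0).mono_left nhdsWithin_le_nhds
  refine mem_closure_of_tendsto hc ?_
  filter_upwards [Ioo_mem_nhdsGT hσ.pos] with s hs
  exact hσ.outside u s hs.1 hs.2

/-- Every point of the curve is a limit of outside points, so none can lie in the open disc. -/
theorem le_norm_sub (hσ : IsInnerSign γ σ ε) (hγ : IsSimpleClosedCurve γ T) {q c : ℂ} {r : ℝ}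
    (h : SupportsFromInsideAt γ q c r) (u : ℝ) : r ≤ ‖γ u - c‖ := by
  by_contra! hlt
  obtain ⟨z, hz, hz'⟩ := mem_closure_iff.1 (hσ.range_subset_closure ⟨u, rfl⟩) _
    Metric.isOpen_ball (show γ u ∈ Metric.ball c r by simpa [dist_eq_norm] using hlt)
  exact hz' (h.closedBall_subset hγ (Metric.ball_subset_closedBall hz))

theorem ball_subset_curveInside (hσ : IsInnerSign γ σ ε) (hγ : IsSimpleClosedCurve γ T) {q c : ℂ}
    {r : ℝ} (h : SupportsFromInsideAt γ q c r) : Metric.ball c r ⊆ curveInside γ := by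
  intro z hz
  refine (h.closedBall_subset hγ (Metric.ball_subset_closedBall hz)).resolve_left ?_
  rintro ⟨u, rfl⟩
  rw [Metric.mem_ball, dist_eq_norm] at hz
  exact not_lt.2 (hσ.le_norm_sub hγ h u) hz

/-- `γ t` is a point of the curve nearest to `c`, so `c` is on the normal. It is on the inner side
because short outward normals leave the region. -/
theorem center_eq (hσ : IsInnerSign γ σ ε) (hγ : IsSimpleClosedCurve γ T) {t : ℝ} {c : ℂ}
    {r : ℝ} (h : SupportsFromInsideAt γ (γ t) c r) : c = γ t + r • σ • unitNormal γ t := by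
  have hr := h.radius_pos
  have ht : ‖γ t - c‖ = r := by simpa [dist_eq_norm] using h.mem_circle
  obtain ⟨s, hs, hc⟩ := hγ.eq_add_smul_unitNormal_of_forall_le (z := c) (u := t)
    fun v => ht.trans_le (hσ.le_norm_sub hγ h v)
  rw [ht] at hs
  have hs' : |s * σ| = r := by rw [abs_mul, hs, hσ.abs_eq, mul_one]
  have hss : s = s * σ * σ := by rw [mul_assoc, ← sq, hσ.sq_eq, mul_one]
  rw [hss, mul_smul] at hc
  rcases (_root_.abs_eq hr.le).1 hs' with h1 | h1
  · rwa [h1] at hc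
  · exfalso
    rw [h1] at hc
    set δ := min ε r / 2 with hδ
    have hδ0 : 0 < δ := by have := hσ.pos; positivity
    have hδε : δ < ε := by linarith [min_le_left ε r]
    have hδr : δ < r := by linarith [min_le_right ε r]
    refine hσ.outside t δ hδ0 hδε (h.closedBall_subset hγ ?_)
    have he : γ t - δ • σ • unitNormal γ t - c = (r - δ) • σ • unitNormal γ t := by
      rw [hc]
      module
    rw [Metric.mem_closedBall, dist_eq_norm, he, norm_smul, hσ.norm_normal hγ, mul_one,
      Real.norm_of_nonneg (by linarith)]
    linarith

/-- Converse of `le_norm_sub`: the open disc is connected, misses the curve and contains a short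
inner normal, hence is inside. -/
theorem supportsFromInsideAt_of_forall_le (hσ : IsInnerSign γ σ ε) (hγ : IsSimpleClosedCurve γ T)
    {t r : ℝ} (hr : 0 < r) (h : ∀ u, r ≤ ‖γ u - (γ t + r • σ • unitNormal γ t)‖) :
    SupportsFromInsideAt γ (γ t) (γ t + r • σ • unitNormal γ t) r := by
  set c := γ t + r • σ • unitNormal γ t with hc
  have hball : Metric.ball c r ⊆ curveInside γ := by
    set δ := min ε r / 2 with hδ
    have hδ0 : 0 < δ := by have := hσ.pos; positivity
    have hδε : δ < ε := by linarith [min_le_left ε r]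
    have hδr : δ < r := by linarith [min_le_right ε r]
    have hd : Disjoint (Metric.ball c r) (Set.range γ) := by
      rw [Set.disjoint_right]
      rintro _ ⟨u, rfl⟩ hu
      exact not_lt.2 (h u) (by simpa [dist_eq_norm] using hu)
    refine (convex_ball c r).isPreconnected.subset_curveInside hd
      (z := γ t + δ • σ • unitNormal γ t) ?_ (hσ.inside t δ hδ0 hδε)
    have he : γ t + δ • σ • unitNormal γ t - c = -((r - δ) • σ • unitNormal γ t) := by
      rw [hc]
      module
    rw [Metric.mem_ball, dist_eq_norm, he, norm_neg, norm_smul, hσ.norm_normal hγ, mul_one,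
      Real.norm_of_nonneg (by linarith)]
    linarith
  refine ⟨hr, ⟨t, rfl⟩, ?_, ?_⟩
  · rw [mem_sphere_iff_norm, hc, sub_add_cancel_left, norm_neg, norm_smul, hσ.norm_normal hγ,
      mul_one, Real.norm_of_nonneg hr.le]
  · refine Metric.sphere_subset_closedBall.trans ?_
    rw [← closure_ball c hr.ne']
    exact closure_minimal (hball.trans Set.subset_union_right) hγ.isClosed_closedRegion

/-- If a supporting disc touches the curve at the endpoints of an arc, then its chord joining these
endpoints together with the arc separates the inner side of the arc from the outside. -/
theorem false_of_isPreconnected_of_crosscut (hσ : IsInnerSign γ σ ε)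
    (hγ : IsSimpleClosedCurve γ T) {q c : ℂ} {r : ℝ} (hD : SupportsFromInsideAt γ q c r)
    {a b m : ℝ} (ham : a < m) (hmb : m < b) (hb : b < a + T) (hac : γ a ∈ Metric.sphere c r)
    (hbc : γ b ∈ Metric.sphere c r) {W : Set ℂ} (hW : IsPreconnected W)
    (hWγ : Disjoint W (γ '' Set.Icc a b)) (hWs : Disjoint W (segment ℝ (γ a) (γ b)))
    (hin : ∀ᶠ δ in 𝓝[>] (0 : ℝ), γ m + δ • σ • unitNormal γ m ∈ W)
    (hout : (W ∩ closure (closedRegion γ)ᶜ).Nonempty) : False := by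
  obtain ⟨w, hwW, hwU⟩ := hout
  have hab : γ a ≠ γ b := fun h => by
    have := hγ.eq_of_abs_sub_lt h (by rw [abs_sub_lt_iff]; constructor <;> linarith)
    linarith
  set U := (closedRegion γ)ᶜ with hU
  -- Since `w` is a limit of outside points, `W` and the connected outside merge into one connected
  -- set, which then contains both ends of a short normal segment at `γ m`.
  have hWU : IsPreconnected (W ∪ insert w U) :=
    hW.union w hwW (Set.mem_insert _ _)
      (hγ.isPreconnected_compl_closedRegion.subset_closure (Set.subset_insert _ _)
        (Set.insert_subset hwU subset_closure))
  have hsegr : segment ℝ (γ a) (γ b) ⊆ closedRegion γ :=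
    ((convex_closedBall c r).segment_subset (Metric.sphere_subset_closedBall hac)
      (Metric.sphere_subset_closedBall hbc)).trans (hD.closedBall_subset hγ)
  set L := γ '' Set.Icc a b ∪ segment ℝ (γ a) (γ b) with hL
  have hLr : L ⊆ closedRegion γ := by
    refine Set.union_subset ?_ hsegr
    rintro _ ⟨u, -, rfl⟩
    exact Or.inl ⟨u, rfl⟩
  have hWL : ∀ z ∈ W, z ∉ L := fun z hz hzL =>
    hzL.elim (Set.disjoint_left.1 hWγ hz) (Set.disjoint_left.1 hWs hz)
  have hWUL : Disjoint (W ∪ insert w U) L := by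
    rw [Set.disjoint_left]
    rintro z (hz | rfl | hz) hzL
    · exact hWL z hz hzL
    · exact hWL z hwW hzL
    · exact hz (hLr hzL)
  -- The closed curve without `γ m` stays connected, the chord joining the two half-arcs.
  set L₀ := γ '' Set.Ico a m ∪ segment ℝ (γ a) (γ b) ∪ γ '' Set.Ioc m b with hL₀
  have hγmseg : γ m ∉ segment ℝ (γ a) (γ b) := by
    intro hmem
    rcases eq_or_ne (γ m) (γ a) with h | hne₁
    · have := hγ.eq_of_abs_sub_lt h (by rw [abs_sub_lt_iff]; constructor <;> linarith)
      linarith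
    rcases eq_or_ne (γ m) (γ b) with h | hne₂
    · have := hγ.eq_of_abs_sub_lt h (by rw [abs_sub_lt_iff]; constructor <;> linarith)
      linarith
    have h1 := mem_openSegment_of_ne_left_right hne₁.symm hne₂.symm hmem
    have h2 := (strictConvex_closedBall ℝ c r).openSegment_subset
      (Metric.sphere_subset_closedBall hac) (Metric.sphere_subset_closedBall hbc) hab h1
    rw [interior_closedBall c hD.radius_pos.ne'] at h2
    exact (hσ.ball_subset_curveInside hγ hD h2).1 ⟨m, rfl⟩
  have hγm : γ m ∉ L₀ := by
    rintro ((⟨u, hu, hum⟩ | h) | ⟨u, hu, hum⟩)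
    · have := hγ.eq_of_abs_sub_lt hum
        (by rw [abs_sub_lt_iff]; constructor <;> linarith [hu.1, hu.2])
      linarith [hu.2]
    · exact hγmseg h
    · have := hγ.eq_of_abs_sub_lt hum
        (by rw [abs_sub_lt_iff]; constructor <;> linarith [hu.1, hu.2])
      linarith [hu.1]
  have hins : insert (γ m) L₀ = L := by
    have : Set.Icc a b = insert m (Set.Ico a m ∪ Set.Ioc m b) := by
      ext u
      simp only [Set.mem_Icc, Set.mem_insert_iff, Set.mem_union, Set.mem_Ico, Set.mem_Ioc]
      constructor
      · rintro ⟨h1, h2⟩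
        rcases lt_trichotomy u m with h | h | h
        · exact Or.inr (Or.inl ⟨h1, h⟩)
        · exact Or.inl h
        · exact Or.inr (Or.inr ⟨h, h2⟩)
      · rintro (rfl | ⟨h1, h2⟩ | ⟨h1, h2⟩) <;> constructor <;> linarith
    rw [hL, hL₀, this, Set.image_insert_eq, Set.image_union, Set.insert_union,
      Set.union_right_comm]
  have hLc : IsCompact L := by
    refine (isCompact_Icc.image hγ.continuous).union ?_
    rw [segment_eq_image_lineMap]
    exact isCompact_Icc.image AffineMap.lineMap_continuous
  have hL₀c : IsPreconnected L₀ := by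
    refine IsPreconnected.union (γ b) (Or.inr (right_mem_segment ℝ _ _))
      ⟨b, ⟨hmb, le_rfl⟩, rfl⟩ (IsPreconnected.union (γ a) ⟨a, ⟨le_rfl, ham⟩, rfl⟩
      (left_mem_segment ℝ _ _) ?_ (convex_segment _ _).isPreconnected) ?_
    · exact isPreconnected_Ico.image _ hγ.continuous.continuousOn
    · exact isPreconnected_Ioc.image _ hγ.continuous.continuousOn
  obtain ⟨δ, hδ0, hδ⟩ := mem_nhdsGT_iff_exists_Ioc_subset.1 (hin.and (Ioo_mem_nhdsGT hσ.pos))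
  have hδ0 : (0 : ℝ) < δ := hδ0
  have hinW : ∀ s : ℝ, 0 < s → s ≤ 1 → γ m + s • δ • σ • unitNormal γ m ∈ W := by
    intro s hs0 hs1
    have := (hδ (a := s * δ) ⟨by positivity, by nlinarith⟩).1
    rwa [mul_smul] at this
  have houtU : ∀ s : ℝ, 0 < s → s ≤ 1 → γ m - s • δ • σ • unitNormal γ m ∈ U := by
    intro s hs0 hs1
    have := (hδ (a := s * δ) ⟨by positivity, by nlinarith⟩).2
    rw [smul_smul]
    exact hσ.outside m _ this.1 this.2
  refine false_of_isPreconnected_of_crosses_once (L₀ := L₀) (v := δ • σ • unitNormal γ m)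
    (hins ▸ hLc) hL₀c (hγ.hasDerivAt m) ?_ ?_ ?_ hWU (hins ▸ hWUL) ?_ ?_
  · filter_upwards [self_mem_nhdsWithin, nhdsWithin_le_nhds (Ioo_mem_nhds ham hmb)] with u hu hu'
    rcases lt_or_gt_of_ne hu with h | h
    · exact Or.inl (Or.inl ⟨u, ⟨hu'.1.le, h⟩, rfl⟩)
    · exact Or.inr ⟨u, ⟨h, hu'.2.le⟩, rfl⟩
  · have hd := (hγ.norm_deriv_pos m).ne'
    have hσ0 : σ ≠ 0 := by
      rintro rfl
      simpa using hσ.sq_eq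
    have hsq : (deriv γ m).re ^ 2 + (deriv γ m).im ^ 2 = ‖deriv γ m‖ ^ 2 := by
      rw [← Complex.normSq_eq_norm_sq, Complex.normSq_apply]; ring
    have he : (deriv γ m * (starRingEnd ℂ) (δ • σ • unitNormal γ m)).im =
        -(δ * σ * ‖deriv γ m‖) := by
      simp only [unitNormal, Complex.real_smul, Complex.div_ofReal_re,
        Complex.mul_re, Complex.mul_im, Complex.conj_re, Complex.conj_im, Complex.I_re,
        Complex.I_im, Complex.div_ofReal_im, Complex.ofReal_re, Complex.ofReal_im]
      field_simp
      linear_combination -δ * σ * hsq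
    rw [he]
    exact neg_ne_zero.2 (by positivity)
  · rintro s ⟨hs1, hs2⟩
    rw [← Complex.real_smul]
    have hL₀L : L₀ ⊆ L := hins ▸ Set.subset_insert _ _
    rcases lt_trichotomy s 0 with h | rfl | h
    · intro hmem
      have := houtU (-s) (by linarith) (by linarith)
      rw [neg_smul, sub_neg_eq_add] at this
      exact this (hLr (hL₀L hmem))
    · simpa using hγm
    · exact fun hmem => hWL _ (hinW s h hs2) (hL₀L hmem)
  · have := houtU 1 one_pos le_rfl
    rw [one_smul] at this
    exact Or.inr (Or.inr this)
  · have := hinW 1 one_pos le_rfl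
    rw [one_smul] at this
    exact Or.inl this

/-- The inner normal enters the second disc at once, and near `γ m` the power for the second circle
is close to zero while that for the first is positive. -/
theorem eventually_mem_radicalCap (hσ : IsInnerSign γ σ ε) (hγ : IsSimpleClosedCurve γ T)
    {c c' : ℂ} {r r' m : ℝ} (hr : 0 ≤ r) (h : SupportsFromInsideAt γ (γ m) c' r')
    (hm : r < ‖γ m - c‖) :
    ∀ᶠ δ in 𝓝[>] (0 : ℝ), γ m + δ • σ • unitNormal γ m ∈ radicalCap c r c' r' := by
  have hr' := h.radius_pos
  have hm' : ‖γ m - c'‖ = r' := by simpa [dist_eq_norm] using h.mem_circle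
  have hcont : Continuous fun δ : ℝ => ‖γ m + δ • σ • unitNormal γ m - c‖ ^ 2 - r ^ 2 -
      (‖γ m + δ • σ • unitNormal γ m - c'‖ ^ 2 - r' ^ 2) := by fun_prop
  have hpos : 0 < ‖γ m + (0 : ℝ) • σ • unitNormal γ m - c‖ ^ 2 - r ^ 2 -
      (‖γ m + (0 : ℝ) • σ • unitNormal γ m - c'‖ ^ 2 - r' ^ 2) := by
    rw [zero_smul, add_zero, hm']
    have := pow_lt_pow_left₀ hm hr two_ne_zero
    linarith
  filter_upwards [Ioo_mem_nhdsGT hr',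
    nhdsWithin_le_nhds (hcont.tendsto 0 (lt_mem_nhds hpos))]
    with δ hδ hδ'
  refine ⟨?_, by simpa using hδ'⟩
  have he : γ m + δ • σ • unitNormal γ m - c' = -((r' - δ) • σ • unitNormal γ m) := by
    rw [hσ.center_eq hγ h]
    module
  rw [he, norm_neg, norm_smul, hσ.norm_normal hγ, mul_one, Real.norm_of_nonneg (by linarith [hδ.2])]
  linarith [hδ.1]

/-- Supporting discs touching the curve at interleaved pairs of points. -/
theorem mem_sphere_of_interleaved (hσ : IsInnerSign γ σ ε) (hγ : IsSimpleClosedCurve γ T)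
    {q c c' : ℂ} {r r' : ℝ} (hD : SupportsFromInsideAt γ q c r) {a b m v : ℝ} (ham : a < m)
    (hmb : m < b) (hb : b < a + T) (hac : γ a ∈ Metric.sphere c r) (hbc : γ b ∈ Metric.sphere c r)
    (hD' : SupportsFromInsideAt γ (γ m) c' r') (hv : γ v ∈ Metric.sphere c' r')
    (hvab : γ v ∉ γ '' Set.Icc a b) : γ m ∈ Metric.sphere c r := by
  have hle := hσ.le_norm_sub hγ hD
  have hle' := hσ.le_norm_sub hγ hD'
  rw [mem_sphere_iff_norm] at *
  by_contra hne
  have hin := hσ.eventually_mem_radicalCap hγ hD.radius_pos.le hD'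
    (lt_of_le_of_ne (hle m) (Ne.symm hne))
  have hcl : γ v ∈ closure (radicalCap c r c' r') := by
    obtain ⟨δ, hδ⟩ := hin.exists
    refine mem_closure_radicalCap ⟨_, hδ⟩ hv.le ?_
    rw [hv]
    have := pow_le_pow_left₀ hD.radius_pos.le (hle v) 2
    linarith
  have hsub : radicalCap c r c' r' ⊆ curveInside γ := fun w hw =>
    hσ.ball_subset_curveInside hγ hD' (by simpa [dist_eq_norm] using hw.1)
  refine hσ.false_of_isPreconnected_of_crosscut hγ hD ham hmb hb (by simpa using hac)
    (by simpa using hbc) (W := insert (γ v) (radicalCap c r c' r')) ?_ ?_ ?_ ?_ ?_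
  · exact (convex_radicalCap c r c' r').isPreconnected.subset_closure (Set.subset_insert _ _)
      (Set.insert_subset hcl subset_closure)
  · rw [Set.disjoint_left]
    rintro z (rfl | hz) hz'
    · exact hvab hz'
    · obtain ⟨u, -, rfl⟩ := hz'
      exact (hsub hz).1 ⟨u, rfl⟩
  · rw [Set.disjoint_insert_left]
    refine ⟨fun hseg => ?_, disjoint_radicalCap_segment hD'.radius_pos.le hac hbc (hle' a) (hle' b)⟩
    have hab : γ a ≠ γ b := fun h => by
      have := hγ.eq_of_abs_sub_lt h (by rw [abs_sub_lt_iff]; constructor <;> linarith)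
      linarith
    have hva : γ a ≠ γ v := fun h => hvab ⟨a, ⟨le_rfl, by linarith⟩, h⟩
    have hvb : γ b ≠ γ v := fun h => hvab ⟨b, ⟨by linarith, le_rfl⟩, h⟩
    have h1 := mem_openSegment_of_ne_left_right hva hvb hseg
    have h2 := (strictConvex_closedBall ℝ c r).openSegment_subset
      (mem_closedBall_iff_norm.2 hac.le) (mem_closedBall_iff_norm.2 hbc.le) hab h1
    rw [interior_closedBall c hD.radius_pos.ne'] at h2
    exact (hσ.ball_subset_curveInside hγ hD h2).1 ⟨v, rfl⟩
  · exact hin.mono fun δ hδ => Or.inr hδ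
  · exact ⟨γ v, Set.mem_insert _ _, hσ.range_subset_closure ⟨v, rfl⟩⟩

/-- A supporting disc touching the curve at a point of an incircle is contained in the incircle. -/
theorem closedBall_subset_of_isIncircle (hσ : IsInnerSign γ σ ε) (hγ : IsSimpleClosedCurve γ T)
    {p q c c' : ℂ} {r r' : ℝ} (hC : IsIncircle γ p c r) {w : ℝ} (hw : γ w ∈ Metric.sphere c r)
    (hD : SupportsFromInsideAt γ q c' r') (hw' : γ w ∈ Metric.sphere c' r') :
    Metric.closedBall c' r' ⊆ Metric.closedBall c r := by
  have hr := hC.1.radius_pos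
  have hr' := hD.radius_pos
  have hc := hσ.center_eq hγ (hC.1.of_mem_sphere hw)
  have hc' := hσ.center_eq hγ (hD.of_mem_sphere hw')
  -- Of two circles tangent at `γ w` from the same side, the larger has the smaller one in its open
  -- disc except at `γ w`. So `r' > r` forces `p = γ w`, against the maximality of the incircle at
  -- `p`.
  have hle : r' ≤ r := by
    obtain ⟨t, rfl⟩ := hC.1.mem_curve
    by_contra! hlt
    have h1 : ‖γ t - c‖ = r := by simpa [dist_eq_norm] using hC.1.mem_circle
    have h2 := hσ.le_norm_sub hγ hD t
    have hN := hσ.norm_normal hγ w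
    set N := σ • unitNormal γ w
    have e1 : γ t - c = (γ t - γ w) - r • N := by rw [hc]; abel
    have e2 : γ t - c' = (γ t - γ w) - r' • N := by rw [hc']; abel
    have h1' : ‖(γ t - γ w) - r • N‖ ^ 2 = r ^ 2 := by rw [← e1, h1]
    have h2' : r' ^ 2 ≤ ‖(γ t - γ w) - r' • N‖ ^ 2 := by
      rw [← e2]; exact pow_le_pow_left₀ hr'.le h2 2
    rw [norm_sub_sq_real, real_inner_smul_right, norm_smul, hN, Real.norm_eq_abs, mul_one,
      sq_abs] at h1' h2'
    have h3 : ‖γ t - γ w‖ ^ 2 ≤ 0 := by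
      have hi : inner ℝ (γ t - γ w) N ≤ 0 := by nlinarith
      nlinarith
    have h4 : γ t = γ w := by
      have : ‖γ t - γ w‖ = 0 := by nlinarith [norm_nonneg (γ t - γ w)]
      exact sub_eq_zero.1 (norm_eq_zero.1 this)
    exact not_lt.2 (hC.2 c' r' (hD.of_mem_sphere (h4 ▸ hw'))) hlt
  refine Metric.closedBall_subset_closedBall' ?_
  have he : c' - c = -((r - r') • σ • unitNormal γ w) := by
    nth_rewrite 1 [hc, hc']
    module
  rw [dist_eq_norm, he, norm_neg, norm_smul, hσ.norm_normal hγ, mul_one,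
    Real.norm_of_nonneg (by linarith)]
  linarith

end IsInnerSign

end Supporting

/-! ### Touching pairs and osculating discs -/

section Touching

variable {γ : ℝ → ℂ} {T σ ε : ℝ}

/-- There is a disc supporting `γ` from inside at `γ s` which is the disc tangent to `γ` at `γ s`
and passing through `γ u`; for `u = s` this is the osculating disc. -/
def IsTouchingPair (γ : ℝ → ℂ) (σ s u : ℝ) : Prop :=
  ∃ (c : ℂ) (r : ℝ), SupportsFromInsideAt γ (γ s) c r ∧ r * (σ * chordCurvature γ s (u - s)) = 1

namespace IsInnerSign

theorem norm_sub_center_sq (hσ : IsInnerSign γ σ ε) (hγ : IsSimpleClosedCurve γ T) {t h r : ℝ}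
    {c : ℂ} (hD : SupportsFromInsideAt γ (γ t) c r) (hh : |h| < T) :
    ‖γ (t + h) - c‖ ^ 2 =
      r ^ 2 + ‖γ (t + h) - γ t‖ ^ 2 * (1 - r * (σ * chordCurvature γ t h)) := by
  have h1 := hγ.norm_sub_normal_sq t hh (r * σ)
  rw [mul_smul, ← hσ.center_eq hγ hD, mul_pow, hσ.sq_eq] at h1
  rw [h1]
  ring

theorem norm_sub_pos (hγ : IsSimpleClosedCurve γ T) {t h : ℝ} (hh : |h| < T) (h0 : h ≠ 0) :
    0 < ‖γ (t + h) - γ t‖ := by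
  rw [norm_pos_iff, sub_ne_zero]
  intro he
  exact h0 (by simpa using hγ.eq_of_abs_sub_lt he (by simpa using hh))

/-- For `h ≠ 0` this says that `γ (t + h)` is not in the open disc; the case `h = 0` follows by
continuity. -/
theorem radius_mul_chordCurvature_le_one (hσ : IsInnerSign γ σ ε) (hγ : IsSimpleClosedCurve γ T)
    {t h r : ℝ} {c : ℂ} (hD : SupportsFromInsideAt γ (γ t) c r) (hh : |h| < T) :
    r * (σ * chordCurvature γ t h) ≤ 1 := by
  have hne : ∀ h, |h| < T → h ≠ 0 → r * (σ * chordCurvature γ t h) ≤ 1 := by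
    intro h hh h0
    have h1 := hσ.norm_sub_center_sq hγ hD hh
    have h2 := pow_le_pow_left₀ hD.radius_pos.le (hσ.le_norm_sub hγ hD (t + h)) 2
    have h3 := pow_pos (norm_sub_pos hγ (t := t) hh h0) 2
    by_contra! hlt
    nlinarith
  rcases eq_or_ne h 0 with rfl | h0
  · have hopen : IsOpen {q : ℝ × ℝ | |q.2| < T} := isOpen_lt (by fun_prop) continuous_const
    have hc : Tendsto (fun h => r * (σ * chordCurvature γ t h)) (𝓝[≠] 0)
        (𝓝 (r * (σ * chordCurvature γ t 0))) := by
      refine Tendsto.const_mul _ (Tendsto.const_mul _ ?_)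
      have h1 := (hγ.continuousOn_chordCurvature.continuousAt (hopen.mem_nhds (x := (t, 0)) hh))
      have h2 : Continuous fun h : ℝ => (t, h) := by fun_prop
      exact (h1.tendsto.comp (h2.tendsto 0)).mono_left nhdsWithin_le_nhds
    refine le_of_tendsto hc ?_
    filter_upwards [self_mem_nhdsWithin, nhdsWithin_le_nhds (Ioo_mem_nhds
      (neg_lt_zero.2 hγ.period_pos) hγ.period_pos)] with h h0 hT
    exact hne h (abs_lt.2 hT) h0
  · exact hne h hh h0

/-- The largest disc supporting the curve from inside at a given point either touches the curve at
another point or is the osculating disc. -/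
theorem exists_supportsFromInsideAt (hσ : IsInnerSign γ σ ε) (hγ : IsSimpleClosedCurve γ T)
    (t : ℝ) : ∃ (c : ℂ) (r h : ℝ), |h| ≤ T / 2 ∧ SupportsFromInsideAt γ (γ t) c r ∧
      r * (σ * chordCurvature γ t h) = 1 := by
  have hT := hγ.period_pos
  have hcont : ContinuousOn (fun h => σ * chordCurvature γ t h) (Set.Icc (-(T / 2)) (T / 2)) := by
    refine ContinuousOn.const_smul (c := σ) ?_
    refine hγ.continuousOn_chordCurvature.comp (f := fun h : ℝ => (t, h)) (by fun_prop) ?_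
    intro h hh
    have := abs_le.2 hh
    show |h| < T
    linarith
  obtain ⟨h, hh, hmax⟩ := isCompact_Icc.exists_isMaxOn
    (Set.nonempty_Icc.2 (by linarith : -(T / 2) ≤ T / 2)) hcont
  have hsupp : ∀ r, 0 < r → (∀ h' ∈ Set.Icc (-(T / 2)) (T / 2),
      r * (σ * chordCurvature γ t h') ≤ 1) →
      SupportsFromInsideAt γ (γ t) (γ t + r • σ • unitNormal γ t) r := by
    intro r hr hle
    refine hσ.supportsFromInsideAt_of_forall_le hγ hr fun u => ?_
    obtain ⟨k, hk, hku⟩ := hγ.exists_abs_le_eq t u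
    have h1 := hγ.norm_sub_normal_sq t (h := k) (by linarith) (r * σ)
    rw [mul_smul, mul_pow, hσ.sq_eq, hku, mul_one, mul_assoc] at h1
    have h2 := hle k (abs_le.1 hk)
    refine le_of_sq_le_sq ?_ (norm_nonneg _)
    rw [h1]
    have := mul_nonneg (sq_nonneg ‖γ u - γ t‖) (sub_nonneg.2 h2)
    linarith
  -- Otherwise discs of every radius would support the curve at `γ t`, but the region is bounded.
  have hpos : 0 < σ * chordCurvature γ t h := by
    by_contra! hneg
    obtain ⟨M, hM⟩ := hγ.isBounded_closedRegion.exists_norm_le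
    have hM0 : 0 ≤ M := (norm_nonneg _).trans (hM (γ t) (Or.inl ⟨t, rfl⟩))
    have h1 := hsupp (M + 1) (by linarith) fun h' hh' =>
      (mul_nonpos_of_nonneg_of_nonpos (by linarith) ((hmax hh').trans hneg)).trans zero_le_one
    have h2 := hM (γ t + (2 * (M + 1)) • σ • unitNormal γ t) (h1.closedBall_subset hγ (by
      rw [mem_closedBall_iff_norm, show γ t + (2 * (M + 1)) • σ • unitNormal γ t -
        (γ t + (M + 1) • σ • unitNormal γ t) = (M + 1) • σ • unitNormal γ t by module,
        norm_smul, hσ.norm_normal hγ, Real.norm_of_nonneg (by linarith), mul_one]))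
    have h3 := norm_sub_le (γ t + (2 * (M + 1)) • σ • unitNormal γ t) (γ t)
    rw [add_sub_cancel_left, norm_smul, hσ.norm_normal hγ, Real.norm_of_nonneg (by linarith)] at h3
    linarith [hM (γ t) (Or.inl ⟨t, rfl⟩)]
  refine ⟨_, (σ * chordCurvature γ t h)⁻¹, h, abs_le.2 hh,
    hsupp _ (inv_pos.2 hpos) fun h' hh' => ?_, inv_mul_cancel₀ hpos.ne'⟩
  rw [inv_mul_le_one₀ hpos]
  exact hmax hh'

theorem isOsculatingCircle (hσ : IsInnerSign γ σ ε) (hγ : IsSimpleClosedCurve γ T) {t r : ℝ}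
    {c : ℂ} (hD : SupportsFromInsideAt γ (γ t) c r) (h : r * (σ * chordCurvature γ t 0) = 1) :
    IsOsculatingCircle γ t c r := by
  rw [IsSimpleClosedCurve.chordCurvature_zero] at h
  have hκ : signedCurvature γ t ≠ 0 := by
    intro h0
    simp [h0] at h
  have hinv : (signedCurvature γ t)⁻¹ = r * σ :=
    inv_eq_of_mul_eq_one_right (by linarith)
  refine ⟨hκ, ?_, ?_⟩
  · rw [hinv, ← Complex.real_smul, mul_smul]
    exact hσ.center_eq hγ hD
  · rw [← abs_inv, hinv, abs_mul, hσ.abs_eq, mul_one, abs_of_pos hD.radius_pos]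

/-- The radius of the largest disc is eliminated in favour of a family of weak inequalities between
continuous functions of `(s, u)`, so that touching pairs form a closed set. -/
theorem isTouchingPair_iff (hσ : IsInnerSign γ σ ε) (hγ : IsSimpleClosedCurve γ T) {s u : ℝ}
    (hsu : |u - s| < T) : IsTouchingPair γ σ s u ↔
      ∀ h, |h| < T → σ * chordCurvature γ s h ≤ σ * chordCurvature γ s (u - s) := by
  constructor
  · rintro ⟨c, r, hD, he⟩ h hh
    have h1 := hσ.radius_mul_chordCurvature_le_one hγ hD hh
    rw [← he] at h1
    exact le_of_mul_le_mul_left h1 hD.radius_pos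
  · intro hle
    obtain ⟨c, r, h, hh, hD, he⟩ := hσ.exists_supportsFromInsideAt hγ s
    refine ⟨c, r, hD, le_antisymm (hσ.radius_mul_chordCurvature_le_one hγ hD hsu) ?_⟩
    rw [← he]
    exact mul_le_mul_of_nonneg_left (hle h (by linarith [hγ.period_pos])) hD.radius_pos.le

theorem mem_sphere_of_eq_one (hσ : IsInnerSign γ σ ε) (hγ : IsSimpleClosedCurve γ T) {t h r : ℝ}
    {c : ℂ} (hD : SupportsFromInsideAt γ (γ t) c r) (hh : |h| < T)
    (he : r * (σ * chordCurvature γ t h) = 1) : γ (t + h) ∈ Metric.sphere c r := by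
  have h1 := hσ.norm_sub_center_sq hγ hD hh
  rw [he, sub_self, mul_zero, add_zero, sq_eq_sq₀ (norm_nonneg _) hD.radius_pos.le] at h1
  simpa [dist_eq_norm] using h1

theorem isTouchingPair_of_mem_sphere (hσ : IsInnerSign γ σ ε) (hγ : IsSimpleClosedCurve γ T)
    {s u r : ℝ} {c : ℂ} (hD : SupportsFromInsideAt γ (γ s) c r) (hne : u ≠ s) (hsu : |u - s| < T)
    (hu : γ u ∈ Metric.sphere c r) : IsTouchingPair γ σ s u := by
  have h1 := hσ.norm_sub_center_sq hγ hD hsu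
  have h2 := norm_sub_pos hγ (t := s) hsu (sub_ne_zero.2 hne)
  rw [add_sub_cancel] at h1 h2
  rw [mem_sphere_iff_norm] at hu
  rw [hu, left_eq_add, mul_eq_zero, or_iff_right (pow_pos h2 2).ne'] at h1
  exact ⟨c, r, hD, by linarith⟩

theorem notMem_image_Icc (hγ : IsSimpleClosedCurve γ T) {a b v : ℝ} (hb : b < v) (hv : v < a + T) :
    γ v ∉ γ '' Set.Icc a b := by
  rintro ⟨u, hu, huv⟩
  have := hγ.eq_of_abs_sub_lt huv
    (by rw [abs_sub_lt_iff]; constructor <;> linarith [hu.1, hu.2])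
  linarith [hu.2]

/-- Between the points of a touching pair there is a supporting osculating disc. -/
theorem exists_isTouchingPair_self (hσ : IsInnerSign γ σ ε) (hγ : IsSimpleClosedCurve γ T)
    {a b s₀ u₀ : ℝ} (hab : b < a + T) (hs₀ : s₀ ∈ Set.Icc a b) (hu₀ : u₀ ∈ Set.Icc a b)
    (h₀ : IsTouchingPair γ σ s₀ u₀) : ∃ t ∈ Set.Icc a b, IsTouchingPair γ σ t t := by
  have hT := hγ.period_pos
  have hlt : ∀ s ∈ Set.Icc a b, ∀ u ∈ Set.Icc a b, |u - s| < T := fun s hs u hu => by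
    rw [abs_sub_lt_iff]
    constructor <;> linarith [hs.1, hs.2, hu.1, hu.2]
  let S : Set (ℝ × ℝ) := Set.Icc a b ×ˢ Set.Icc a b
  let K : Set (ℝ × ℝ) := {q ∈ S | IsTouchingPair γ σ q.1 q.2}
  have hKS : K = S ∩ ⋂ h ∈ Set.Ioo (-T) T, {q ∈ S | σ * chordCurvature γ q.1 h ≤
      σ * chordCurvature γ q.1 (q.2 - q.1)} := by
    ext q
    simp only [K, Set.mem_ofPred_eq, Set.mem_inter_iff, Set.mem_iInter, Set.mem_Ioo, ← abs_lt]
    refine and_congr_right fun hq => ?_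
    rw [hσ.isTouchingPair_iff hγ (hlt _ hq.1 _ hq.2)]
    exact ⟨fun h k hk => ⟨hq, h k hk⟩, fun h k hk => (h k hk).2⟩
  have hScl : IsClosed S := isClosed_Icc.prod isClosed_Icc
  have hKc : IsCompact K := by
    rw [hKS]
    refine (isCompact_Icc.prod isCompact_Icc).inter_right (isClosed_biInter fun h hh => ?_)
    refine hScl.isClosed_le (ContinuousOn.const_smul (c := σ) ?_)
      (ContinuousOn.const_smul (c := σ) ?_)
    · exact hγ.continuousOn_chordCurvature.comp (f := fun q : ℝ × ℝ => (q.1, h)) (by fun_prop)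
        fun q _ => abs_lt.2 hh
    · exact hγ.continuousOn_chordCurvature.comp (f := fun q : ℝ × ℝ => (q.1, q.2 - q.1))
        (by fun_prop) fun q hq => hlt _ hq.1 _ hq.2
  -- A touching pair with closest parameters. If `u ≠ s`, the midpoint `m` is off the circle, since
  -- otherwise `s` and `m` would form a closer pair.
  obtain ⟨⟨s, u⟩, ⟨⟨hs, hu⟩, hsu⟩, hmin⟩ := hKc.exists_isMinOn
    ⟨(s₀, u₀), ⟨hs₀, hu₀⟩, h₀⟩ (f := fun q => |q.2 - q.1|) (by fun_prop)
  have hs : s ∈ Set.Icc a b := hs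
  have hu : u ∈ Set.Icc a b := hu
  have hmin' : ∀ s' ∈ Set.Icc a b, ∀ u' ∈ Set.Icc a b, IsTouchingPair γ σ s' u' →
      |u - s| ≤ |u' - s'| := fun s' hs' u' hu' h => hmin (a := (s', u')) ⟨⟨hs', hu'⟩, h⟩
  rcases eq_or_ne u s with rfl | hne
  · exact ⟨u, hu, hsu⟩
  exfalso
  obtain ⟨c, r, hD, he⟩ := hsu
  have huc : γ u ∈ Metric.sphere c r := by
    simpa using hσ.mem_sphere_of_eq_one hγ hD (hlt s hs u hu) he
  have hsc : γ s ∈ Metric.sphere c r := hD.mem_circle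
  set x := min s u with hx
  set y := max s u with hy
  have hxc : γ x ∈ Metric.sphere c r := by
    rcases min_choice s u with h | h <;> rw [hx, h] <;> assumption
  have hyc : γ y ∈ Metric.sphere c r := by
    rcases max_choice s u with h | h <;> rw [hy, h] <;> assumption
  have hxy : x < y := min_lt_max.2 hne.symm
  have habs : |u - s| = y - x := by rw [hx, hy, max_sub_min_eq_abs]
  have hxa : a ≤ x := le_min hs.1 hu.1
  have hyb : y ≤ b := max_le hs.2 hu.2
  set m := (x + y) / 2 with hm
  have hxm : x < m := by linarith
  have hmy : m < y := by linarith
  have hmI : m ∈ Set.Icc a b := ⟨by linarith, by linarith⟩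
  have hmc : γ m ∉ Metric.sphere c r := by
    intro hmem
    have hsxy : s = x ∨ s = y := by
      rcases le_total s u with h | h
      · exact Or.inl (min_eq_left h).symm
      · exact Or.inr (max_eq_left h).symm
    have hms : |m - s| < y - x := by
      rw [abs_lt]
      rcases hsxy with h | h <;> rw [h] <;> constructor <;> linarith
    have hms' : m ≠ s := fun hms' => by rcases hsxy with h | h <;> linarith
    have := hmin' s hs m hmI (hσ.isTouchingPair_of_mem_sphere hγ hD hms' (hlt s hs m hmI) hmem)
    linarith
  obtain ⟨c', r', h, hh, hD', he'⟩ := hσ.exists_supportsFromInsideAt hγ m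
  have hhT : |h| < T := by linarith
  have h0 : h ≠ 0 := by
    rintro rfl
    have := hmin' m hmI m hmI ⟨c', r', hD', by simpa using he'⟩
    rw [sub_self, abs_zero] at this
    linarith
  obtain ⟨v, hv, hvh⟩ := hγ.periodic.exists_mem_Ico hT (m + h) x
  have hvc : γ v ∈ Metric.sphere c' r' := hvh ▸ hσ.mem_sphere_of_eq_one hγ hD' hhT he'
  have hvm : v ≠ m := by
    intro hvm
    have := norm_sub_pos hγ (t := m) hhT h0
    rw [hvh, hvm, sub_self, norm_zero] at this
    exact this.false
  -- The second contact `v` of the largest disc at `m` either lies between `x` and `y`, making a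
  -- closer pair with `m`, or interleaves with them.
  rcases le_or_gt v y with hvy | hvy
  · have hvI : v ∈ Set.Icc a b := ⟨by linarith [hv.1], by linarith⟩
    have h1 := hmin' m hmI v hvI
      (hσ.isTouchingPair_of_mem_sphere hγ hD' hvm (hlt m hmI v hvI) hvc)
    have h2 : |v - m| < y - x := by
      rw [abs_lt]
      constructor <;> linarith [hv.1]
    linarith
  · exact hmc (hσ.mem_sphere_of_interleaved hγ hD hxm hmy (by linarith) hxc hyc hD' hvc
      (notMem_image_Icc hγ hvy hv.2))

/-- Otherwise the incircle's disc would contain this disc, hence `γ t`, which would then lie on the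
incircle. -/
theorem notMem_sphere_of_isIncircle (hσ : IsInnerSign γ σ ε) (hγ : IsSimpleClosedCurve γ T)
    {p c c' : ℂ} {r r' t : ℝ} (hC : IsIncircle γ p c r) (ht : γ t ∉ Metric.sphere c r)
    (hD : SupportsFromInsideAt γ (γ t) c' r') {w : ℝ} (hw : γ w ∈ Metric.sphere c' r') :
    γ w ∉ Metric.sphere c r := by
  intro hwc
  have h1 := hσ.closedBall_subset_of_isIncircle hγ hC hwc hD hw
    (Metric.sphere_subset_closedBall hD.mem_circle)
  have h2 := hσ.le_norm_sub hγ hC.1 t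
  rw [mem_closedBall_iff_norm] at h1
  exact ht (mem_sphere_iff_norm.2 (le_antisymm h1 h2))

theorem exists_isOsculatingCircle_of_isArcTouchingOnlyAtEnds (hσ : IsInnerSign γ σ ε)
    (hγ : IsSimpleClosedCurve γ T) {p c : ℂ} {r : ℝ} (hC : IsIncircle γ p c r) {a b : ℝ}
    (hab : IsArcTouchingOnlyAtEnds γ T c r a b) :
    ∃ t ∈ Set.Ioo a b, ∃ (c' : ℂ) (r' : ℝ),
      IsOsculatingCircle γ t c' r' ∧ SupportsFromInsideAt γ (γ t) c' r' := by
  have hT := hγ.period_pos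
  have hlt := hab.lt
  have hle := hab.le
  suffices h : ∃ t ∈ Set.Ioo a b, IsTouchingPair γ σ t t by
    obtain ⟨t, ht, c', r', hD, he⟩ := h
    exact ⟨t, ht, c', r', hσ.isOsculatingCircle hγ hD (by simpa using he), hD⟩
  set m := (a + b) / 2 with hm
  have ham : a < m := by linarith
  have hmb : m < b := by linarith
  have hmc := hab.not_mem m ⟨ham, hmb⟩
  obtain ⟨c', r', h, hh, hD, he⟩ := hσ.exists_supportsFromInsideAt hγ m
  have hhT : |h| < T := by linarith
  rcases eq_or_ne h 0 with rfl | h0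
  · exact ⟨m, ⟨ham, hmb⟩, c', r', hD, by simpa using he⟩
  obtain ⟨v, hv, hvh⟩ := hγ.periodic.exists_mem_Ico hT (m + h) a
  have hvc : γ v ∈ Metric.sphere c' r' := hvh ▸ hσ.mem_sphere_of_eq_one hγ hD hhT he
  have hvm : v ≠ m := by
    intro hvm
    have := norm_sub_pos hγ (t := m) hhT h0
    rw [hvh, hvm, sub_self, norm_zero] at this
    exact this.false
  have hvC := hσ.notMem_sphere_of_isIncircle hγ hC hmc hD hvc
  have hva : a < v := lt_of_le_of_ne hv.1 fun h => hvC (h ▸ hab.left_mem)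
  have hvb : v < b := by
    -- For a loop, `b = a + T`, this case is void, because `v < a + T`.
    by_contra! hbv
    have hbv : b < v := lt_of_le_of_ne hbv fun h => hvC (h ▸ hab.right_mem)
    exact hmc (hσ.mem_sphere_of_interleaved hγ hC.1 ham hmb (hbv.trans hv.2) hab.left_mem
      hab.right_mem hD hvc (notMem_image_Icc hγ hbv hv.2))
  have hsub : Set.Icc (min m v) (max m v) ⊆ Set.Ioo a b := fun t ht =>
    ⟨(lt_min ham hva).trans_le ht.1, ht.2.trans_lt (max_lt hmb hvb)⟩
  have hpair : IsTouchingPair γ σ m v := by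
    refine hσ.isTouchingPair_of_mem_sphere hγ hD hvm ?_ hvc
    rw [abs_sub_lt_iff]
    constructor <;> linarith
  obtain ⟨t, ht, htt⟩ := hσ.exists_isTouchingPair_self hγ (a := min m v) (b := max m v)
    (by linarith [lt_min ham hva, max_lt hmb hvb])
    ⟨min_le_left _ _, le_max_left _ _⟩ ⟨min_le_right _ _, le_max_right _ _⟩ hpair
  exact ⟨t, hsub ht, htt⟩

end IsInnerSign

/-! ### Discs touching different arcs -/

/-- After a shift by a multiple of the period the parameter intervals overlap. Neither has an
endpoint of the other in its interior, as endpoints lie on the circle, so they agree. -/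
theorem IsArcTouchingOnlyAtEnds.image_eq_of_mem (hγ : IsSimpleClosedCurve γ T) {c : ℂ}
    {r a₁ b₁ a₂ b₂ t : ℝ} (h₁ : IsArcTouchingOnlyAtEnds γ T c r a₁ b₁)
    (h₂ : IsArcTouchingOnlyAtEnds γ T c r a₂ b₂) (ht : t ∈ Set.Ioo a₂ b₂)
    (hmem : γ t ∈ γ '' Set.Icc a₁ b₁) : γ '' Set.Icc a₁ b₁ = γ '' Set.Icc a₂ b₂ := by
  obtain ⟨u, hu, hut⟩ := hmem
  have hnt := h₂.not_mem t ht
  have hua : a₁ < u := lt_of_le_of_ne hu.1 fun h => hnt (hut ▸ h ▸ h₁.left_mem)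
  have hub : u < b₁ := lt_of_le_of_ne hu.2 fun h => hnt (hut ▸ h ▸ h₁.right_mem)
  obtain ⟨k, rfl⟩ := hγ.exists_int_of_eq hut
  have hper : ∀ x, γ (x + k * T) = γ x := hγ.periodic.int_mul k
  have hper' : ∀ x, γ (x - k * T) = γ x := fun x => hγ.periodic.sub_int_mul_eq k
  have ha : a₁ = a₂ + k * T := by
    rcases lt_trichotomy a₁ (a₂ + k * T) with h | h | h
    · exact absurd ((hper a₂).symm ▸ h₂.left_mem) (h₁.not_mem _ ⟨h, by linarith [ht.1]⟩)
    · exact h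
    · exact absurd ((hper' a₁).symm ▸ h₁.left_mem)
        (h₂.not_mem (a₁ - k * T) ⟨by linarith, by linarith [ht.2]⟩)
  have hb : b₁ = b₂ + k * T := by
    rcases lt_trichotomy b₁ (b₂ + k * T) with h | h | h
    · exact absurd ((hper' b₁).symm ▸ h₁.right_mem)
        (h₂.not_mem (b₁ - k * T) ⟨by linarith [ht.1], by linarith⟩)
    · exact h
    · exact absurd ((hper b₂).symm ▸ h₂.right_mem) (h₁.not_mem _ ⟨by linarith [ht.2], h⟩)
  rw [ha, hb, ← Set.image_add_const_Icc, Set.image_image]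
  exact Set.image_congr fun x _ => hper x

namespace IsInnerSign

/-- Two supporting discs touching the curve in different arcs cut out by an incircle do not
intersect outside of the open disc bounded by the incircle, except possibly on the first arc. -/
theorem mem_image_of_mem_closedBall (hσ : IsInnerSign γ σ ε) (hγ : IsSimpleClosedCurve γ T)
    {p c c₁ c₂ z : ℂ} {r r₁ r₂ a b t₁ t₂ : ℝ} (hC : SupportsFromInsideAt γ p c r)
    (hab : IsArcTouchingOnlyAtEnds γ T c r a b) (ht₁ : t₁ ∈ Set.Ioo a b)
    (ht₂ : γ t₂ ∉ γ '' Set.Icc a b) (ht₂' : γ t₂ ∉ Metric.sphere c r)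
    (hD₁ : SupportsFromInsideAt γ (γ t₁) c₁ r₁) (hD₂ : SupportsFromInsideAt γ (γ t₂) c₂ r₂)
    (hz₁ : z ∈ Metric.closedBall c₁ r₁) (hz₂ : z ∈ Metric.closedBall c₂ r₂)
    (hz : z ∉ Metric.ball c r) : z ∈ γ '' Set.Icc a b := by
  by_contra hzγ
  have hlt := hab.lt
  have hb : b < a + T := by
    refine lt_of_le_of_ne hab.le ?_
    rintro rfl
    rw [hγ.periodic.image_Icc hγ.period_pos] at ht₂
    exact ht₂ ⟨t₂, rfl⟩
  have habne : γ a ≠ γ b := fun h => by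
    have := hγ.eq_of_abs_sub_lt h (by rw [abs_sub_lt_iff]; constructor <;> linarith)
    linarith
  have hac := mem_sphere_iff_norm.1 hab.left_mem
  have hbc := mem_sphere_iff_norm.1 hab.right_mem
  rw [mem_closedBall_iff_norm] at hz₁ hz₂
  rw [mem_ball_iff_norm, not_lt] at hz
  have hr := hC.radius_pos.le
  have hpos : ∀ t, γ t ∉ Metric.sphere c r → r < ‖γ t - c‖ := fun t ht =>
    lt_of_le_of_ne (hσ.le_norm_sub hγ hC t) fun h => ht (mem_sphere_iff_norm.2 h.symm)
  have hin₁ := hσ.eventually_mem_radicalCap hγ hr hD₁ (hpos t₁ (hab.not_mem t₁ ht₁))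
  have hin₂ := hσ.eventually_mem_radicalCap hγ hr hD₂ (hpos t₂ ht₂')
  have hcl : ∀ c' r', (radicalCap c r c' r').Nonempty → 0 < r' → ∀ y, ‖y - c'‖ ≤ r' →
      r ≤ ‖y - c‖ → y ∈ closure (radicalCap c r c' r') := by
    intro c' r' hne hr' y hy hy'
    refine mem_closure_radicalCap hne hy ?_
    have h1 := pow_le_pow_left₀ hr hy' 2
    have h2 := pow_le_pow_left₀ (norm_nonneg _) hy 2
    linarith
  have hcl₁ := hcl c₁ r₁ ⟨_, hin₁.exists.choose_spec⟩ hD₁.radius_pos z hz₁ hz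
  have hcl₂ := hcl c₂ r₂ ⟨_, hin₂.exists.choose_spec⟩ hD₂.radius_pos z hz₂ hz
  have hcl₂' := hcl c₂ r₂ ⟨_, hin₂.exists.choose_spec⟩ hD₂.radius_pos (γ t₂)
    (mem_sphere_iff_norm.1 hD₂.mem_circle).le (hpos t₂ ht₂').le
  have hcap : ∀ {q c' r'}, SupportsFromInsideAt γ q c' r' →
      Disjoint (radicalCap c r c' r') (γ '' Set.Icc a b) ∧
      Disjoint (radicalCap c r c' r') (segment ℝ (γ a) (γ b)) := by
    intro q c' r' hD
    refine ⟨?_, disjoint_radicalCap_segment hD.radius_pos.le hac hbc (hσ.le_norm_sub hγ hD a)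
      (hσ.le_norm_sub hγ hD b)⟩
    rw [Set.disjoint_left]
    rintro _ hw ⟨u, -, rfl⟩
    exact not_lt.2 (hσ.le_norm_sub hγ hD u) hw.1
  have hseg : ∀ w, r ≤ ‖w - c‖ → w ∉ γ '' Set.Icc a b → w ∉ segment ℝ (γ a) (γ b) := by
    intro w hw hwγ hws
    have hwa : γ a ≠ w := fun h => hwγ ⟨a, ⟨le_rfl, hlt.le⟩, h⟩
    have hwb : γ b ≠ w := fun h => hwγ ⟨b, ⟨hlt.le, le_rfl⟩, h⟩
    have h1 := mem_openSegment_of_ne_left_right hwa hwb hws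
    have h2 := (strictConvex_closedBall ℝ c r).openSegment_subset
      (mem_closedBall_iff_norm.2 hac.le) (mem_closedBall_iff_norm.2 hbc.le) habne h1
    rw [interior_closedBall c hC.radius_pos.ne', mem_ball_iff_norm] at h2
    exact not_lt.2 hw h2
  have hW₁ : IsPreconnected (insert z (radicalCap c r c₁ r₁)) :=
    (convex_radicalCap c r c₁ r₁).isPreconnected.subset_closure (Set.subset_insert _ _)
      (Set.insert_subset hcl₁ subset_closure)
  have hW₂ : IsPreconnected (insert z (insert (γ t₂) (radicalCap c r c₂ r₂))) :=
    (convex_radicalCap c r c₂ r₂).isPreconnected.subset_closure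
      ((Set.subset_insert _ _).trans (Set.subset_insert _ _))
      (Set.insert_subset hcl₂ (Set.insert_subset hcl₂' subset_closure))
  -- The connected set consists of both caps joined at `z`, with `γ t₂` added as the point where the
  -- outside is approached.
  refine hσ.false_of_isPreconnected_of_crosscut hγ hC ht₁.1 ht₁.2 hb hab.left_mem hab.right_mem
    (hW₁.union z (Set.mem_insert _ _) (Set.mem_insert _ _) hW₂) ?_ ?_ ?_ ?_
  · simp only [Set.disjoint_union_left, Set.disjoint_insert_left]
    exact ⟨⟨hzγ, (hcap hD₁).1⟩, hzγ, ht₂, (hcap hD₂).1⟩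
  · simp only [Set.disjoint_union_left, Set.disjoint_insert_left]
    exact ⟨⟨hseg z hz hzγ, (hcap hD₁).2⟩, hseg z hz hzγ, hseg _ (hpos t₂ ht₂').le ht₂,
      (hcap hD₂).2⟩
  · exact hin₁.mono fun δ hδ => Or.inl (Or.inr hδ)
  · exact ⟨γ t₂, Or.inr (Or.inr (Or.inl rfl)), hσ.range_subset_closure ⟨t₂, rfl⟩⟩

theorem inter_closedBall_subset_ball (hσ : IsInnerSign γ σ ε) (hγ : IsSimpleClosedCurve γ T)
    {p c c₁ c₂ : ℂ} {r r₁ r₂ a₁ b₁ a₂ b₂ t₁ t₂ : ℝ} (hC : IsIncircle γ p c r)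
    (h₁ : IsArcTouchingOnlyAtEnds γ T c r a₁ b₁) (h₂ : IsArcTouchingOnlyAtEnds γ T c r a₂ b₂)
    (hne : γ '' Set.Icc a₁ b₁ ≠ γ '' Set.Icc a₂ b₂) (ht₁ : t₁ ∈ Set.Ioo a₁ b₁)
    (ht₂ : t₂ ∈ Set.Ioo a₂ b₂) (hD₁ : SupportsFromInsideAt γ (γ t₁) c₁ r₁)
    (hD₂ : SupportsFromInsideAt γ (γ t₂) c₂ r₂) :
    Metric.closedBall c₁ r₁ ∩ Metric.closedBall c₂ r₂ ⊆ Metric.ball c r := by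
  rintro z ⟨hz₁, hz₂⟩
  by_contra hz
  have hm₂ : γ t₂ ∉ γ '' Set.Icc a₁ b₁ := fun h => hne (h₁.image_eq_of_mem hγ h₂ ht₂ h)
  have hm₁ : γ t₁ ∉ γ '' Set.Icc a₂ b₂ := fun h => hne (h₂.image_eq_of_mem hγ h₁ ht₁ h).symm
  have hn₁ := h₁.not_mem t₁ ht₁
  have hn₂ := h₂.not_mem t₂ ht₂
  obtain ⟨u, hu, rfl⟩ := hσ.mem_image_of_mem_closedBall hγ hC.1 h₁ ht₁ hm₂ hn₂ hD₁ hD₂ hz₁ hz₂ hz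
  have hu₂ := hσ.mem_image_of_mem_closedBall hγ hC.1 h₂ ht₂ hm₁ hn₁ hD₂ hD₁ hz₂ hz₁ hz
  have hu₁ : γ u ∈ Metric.sphere c₁ r₁ :=
    mem_sphere_iff_norm.2 (le_antisymm (mem_closedBall_iff_norm.1 hz₁) (hσ.le_norm_sub hγ hD₁ u))
  have huC : γ u ∉ Metric.sphere c r := hσ.notMem_sphere_of_isIncircle hγ hC hn₁ hD₁ hu₁
  have hua : a₁ < u := lt_of_le_of_ne hu.1 fun h => huC (h ▸ h₁.left_mem)
  have hub : u < b₁ := lt_of_le_of_ne hu.2 fun h => huC (h ▸ h₁.right_mem)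
  exact hne (h₂.image_eq_of_mem hγ h₁ ⟨hua, hub⟩ hu₂).symm

theorem closedBall_subset_of_notMem_Ioo (hσ : IsInnerSign γ σ ε) (hγ : IsSimpleClosedCurve γ T)
    {p c c' : ℂ} {r r' a b t : ℝ} (hC : IsIncircle γ p c r)
    (hab : IsArcTouchingOnlyAtEnds γ T c r a b) (ht : t ∈ Set.Icc a b) (ht' : t ∉ Set.Ioo a b)
    (hD : SupportsFromInsideAt γ (γ t) c' r') : Metric.closedBall c' r' ⊆ Metric.closedBall c r := by
  refine hσ.closedBall_subset_of_isIncircle hγ hC ?_ hD hD.mem_circle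
  rcases eq_or_lt_of_le ht.1 with rfl | h1
  · exact hab.left_mem
  rcases eq_or_lt_of_le ht.2 with rfl | h2
  · exact hab.right_mem
  · exact absurd ⟨h1, h2⟩ ht'

end IsInnerSign

end Touching

theorem mainTheorem2 (γ : ℝ → ℂ) (T : ℝ) (hγ : IsSimpleClosedCurve γ T)
    (p : ℂ) (hp : p ∈ Set.range γ) (c : ℂ) (r : ℝ) (hC : IsIncircle γ p c r) :
    (∀ a b : ℝ, IsArcTouchingOnlyAtEnds γ T c r a b →
      ∃ t ∈ Set.Ioo a b, ∃ (c' : ℂ) (r' : ℝ),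
        IsOsculatingCircle γ t c' r' ∧ SupportsFromInsideAt γ (γ t) c' r') ∧
    (∀ a₁ b₁ a₂ b₂ : ℝ,
      IsArcTouchingOnlyAtEnds γ T c r a₁ b₁ → IsArcTouchingOnlyAtEnds γ T c r a₂ b₂ →
      γ '' Set.Icc a₁ b₁ ≠ γ '' Set.Icc a₂ b₂ →
      ∀ t₁ ∈ Set.Icc a₁ b₁, ∀ t₂ ∈ Set.Icc a₂ b₂, ∀ (c₁ : ℂ) (r₁ : ℝ) (c₂ : ℂ) (r₂ : ℝ),
        IsOsculatingCircle γ t₁ c₁ r₁ → SupportsFromInsideAt γ (γ t₁) c₁ r₁ →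
        IsOsculatingCircle γ t₂ c₂ r₂ → SupportsFromInsideAt γ (γ t₂) c₂ r₂ →
        Metric.closedBall c₁ r₁ ∩ Metric.closedBall c₂ r₂ ⊆ Metric.closedBall c r ∧
        (t₁ ∈ Set.Ioo a₁ b₁ → t₂ ∈ Set.Ioo a₂ b₂ →
          Metric.closedBall c₁ r₁ ∩ Metric.closedBall c₂ r₂ ⊆ Metric.ball c r)) := by

  obtain ⟨σ, ε, hσ⟩ := exists_isInnerSign hγ hC.1.radius_pos
    ⟨p, hC.1.mem_circle, hp⟩ hC.1.subset_region
  refine ⟨fun a b hab => hσ.exists_isOsculatingCircle_of_isArcTouchingOnlyAtEnds hγ hC hab, ?_⟩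
  intro a₁ b₁ a₂ b₂ h₁ h₂ hne t₁ ht₁ t₂ ht₂ c₁ r₁ c₂ r₂ _ hD₁ _ hD₂
  have hint : t₁ ∈ Set.Ioo a₁ b₁ → t₂ ∈ Set.Ioo a₂ b₂ →
      Metric.closedBall c₁ r₁ ∩ Metric.closedBall c₂ r₂ ⊆ Metric.ball c r := fun hi₁ hi₂ =>
    hσ.inter_closedBall_subset_ball hγ hC h₁ h₂ hne hi₁ hi₂ hD₁ hD₂
  refine ⟨?_, hint⟩
  -- When a contact is an endpoint of its arc, its disc alone already lies in the closed disc of the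
  -- incircle.
  by_cases hi₁ : t₁ ∈ Set.Ioo a₁ b₁
  · by_cases hi₂ : t₂ ∈ Set.Ioo a₂ b₂
    · exact (hint hi₁ hi₂).trans Metric.ball_subset_closedBall
    · exact Set.inter_subset_right.trans
        (hσ.closedBall_subset_of_notMem_Ioo hγ hC h₂ ht₂ hi₂ hD₂)
  · exact Set.inter_subset_left.trans
      (hσ.closedBall_subset_of_notMem_Ioo hγ hC h₁ ht₁ hi₁ hD₁)
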